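/- For a finite simple graph $G=(V,E)$ and vertex subsets $X,Y\subseteq V$ (not necessarily disjoint), let $e(X,Y)$ be the number of pairs $(x,y)\in X\times Y$ that are edges of $G$, let $d(X,Y)=e(X,Y)/(|X||Y|)$ for nonempty $X,Y$, and put $$\mathrm{irreg}(X,Y)=\max_{U\subseteq X,\ W\subseteq Y}\bigl|e(U,W)-|U||W|\,d(X,Y)\bigr| .$$ The irregularity of a partition $\mathcal P$ of $V$ into nonempty parts is $\mathrm{irreg}(\mathcal P)=\sum_{X,Y\in\mathcal P}\mathrm{irreg}(X,Y)$, the sum being over all ordered pairs of parts, including $X=Y$. A partition is equitable if any two of its parts differ in size by at most one. For $\epsilon>0$ let $M(\epsilon)$ be the smallest integer $m$ such that every finite graph $G=(V,E)$ has a vertex partition into at most $m$ parts with irregularity at most $\epsilon|V|^2$, and let $M_{eq}(\epsilon)$ be the smallest integer $m$ such that every finite graph $G=(V,E)$ has an equitable vertex partition into at most $m$ parts with irregularity at most $\epsilon|V|^2$. **Theorem 2.2.** There is an absolute constant $C>0$ such that for all real $0<\epsilon<1$ and $0<\alpha<1/2$ the integers $M(\epsilon)$ and $M_{eq}(\epsilon+\alpha)$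 exist and $$M_{eq}(\epsilon+\alpha)\le \alpha^{-C}\,M(\epsilon).$$ -/

import Mathlib

open Finset

noncomputable section

namespace EquitableRegularity

/-- The irregularity of a pair `X, Y` of (not necessarily disjoint) vertex subsets of `G`:
the maximum of `|e(U, W) - |U| |W| d(X, Y)|` over all `U ⊆ X` and `W ⊆ Y`, where `e(U, W)` is the
number of pairs `(u, w) ∈ U × W` that are edges and `d(X, Y) = e(X, Y) / (|X| |Y|)`. -/
def pairIrreg {V : Type} (G : SimpleGraph V) [DecidableRel G.Adj] (X Y : Finset V) : ℝ :=
  (X.powerset ×ˢ Y.powerset).sup'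
    ((Finset.powerset_nonempty X).product (Finset.powerset_nonempty Y))
    fun p => |(#(G.interedges p.1 p.2) : ℝ) - (#p.1 : ℝ) * (#p.2 : ℝ) * (G.edgeDensity X Y : ℝ)|

/-- The irregularity of a vertex partition: the sum of the irregularities of all ordered pairs
`(X, Y)` of parts, the pairs with `X = Y` included. -/
def irreg {V : Type} [Fintype V] [DecidableEq V] (G : SimpleGraph V) [DecidableRel G.Adj]
    (P : Finpartition (univ : Finset V)) : ℝ :=
  ∑ X ∈ P.parts, ∑ Y ∈ P.parts, pairIrreg G X Y

/-- The numbers `m` such that every finite graph `G = (V, E)` has a vertex partition into at most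
`m` parts with irregularity at most `ε |V| ^ 2`. -/
def sufficientParts (ε : ℝ) : Set ℕ :=
  {m | ∀ (V : Type) [Fintype V] [DecidableEq V] (G : SimpleGraph V) [DecidableRel G.Adj],
    ∃ P : Finpartition (univ : Finset V),
      #P.parts ≤ m ∧ irreg G P ≤ ε * (Fintype.card V : ℝ) ^ 2}

/-- The numbers `m` such that every finite graph `G = (V, E)` has an equitable vertex partition
(any two parts differ in size by at most one) into at most `m` parts with irregularity at most
`ε |V| ^ 2`. -/
def sufficientEquitableParts (ε : ℝ) : Set ℕ :=
  {m | ∀ (V : Type) [Fintype V] [DecidableEq V] (G : SimpleGraph V) [DecidableRel G.Adj],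
    ∃ P : Finpartition (univ : Finset V),
      P.IsEquipartition ∧ #P.parts ≤ m ∧ irreg G P ≤ ε * (Fintype.card V : ℝ) ^ 2}

/-- `M(ε)`: the least number of parts that always suffices. -/
def M (ε : ℝ) : ℕ := sInf (sufficientParts ε)

/-- `M_eq(ε)`: the least number of parts that always suffices for equitable partitions. -/
def Meq (ε : ℝ) : ℕ := sInf (sufficientEquitableParts ε)

end EquitableRegularity

end

open Finset
open scoped BigOperators

noncomputable section

namespace EquitableRegularity

/-! Start from a partition with at most m parts and irregularity at most ε n². Cut each part into
blocks of a common size t, about α n / (18 m), and spread the at most m t left-over vertices evenly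
over the blocks. The result is equitable, has O(m / α) parts, and the left-over vertices affect only
O(m t n) pairs. Refining may raise the irregularity, but cutting at random prevents this on average.

For the random cut the blocked vertices stand in t rows, and every row is permuted independently
within the parts, so a block receives one random vertex from each row. Symmetrization and
contraction (`expect_iSup_sum_le`) show that the cut norm on such a sample is at most its
proportional share plus O(√t) per vertex of the other side (`expect_cut_right_le`). Used on both
sides, this charges a pair of blocks O(t^(3/2)) beyond its share (`expect_cut_block_le`); the shares
add up to the original irregularity (`exists_rearrangement`).

With K blocks, the error K² t^(3/2) ≤ n² / √t is below a multiple of α n² once t is at least a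
constant times α⁻². If n is too small for this, the partition into singletons has irregularity 0 and
at most 2^14 α⁻³ m parts. -/

/-! ### Symmetrization and contraction for suprema of random sums. -/

/-- The sign `±1` encoded by a Boolean. -/
def sgn (b : Bool) : ℝ := cond b 1 (-1)

lemma abs_sgn (b : Bool) : |sgn b| = 1 := by cases b <;> simp [sgn]

lemma le_iSup_of_finite {T : Type*} [Finite T] (f : T → ℝ) (τ : T) : f τ ≤ ⨆ τ, f τ :=
  le_ciSup (Set.finite_range f).bddAbove τ

lemma expect_fin_cons {Ω : Type*} [Fintype Ω] {n : ℕ} (F : (Fin (n + 1) → Ω) → ℝ) :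
    𝔼 z, F z = 𝔼 a, 𝔼 z : Fin n → Ω, F (Fin.cons a z) := by
  rw [← expect_product', univ_product_univ]
  exact (Fintype.expect_equiv (Fin.consEquiv fun _ => Ω) _ _ fun _ => rfl).symm

lemma expect_prod_bool {Ω : Type*} [Fintype Ω] (F : Ω × Bool → ℝ) :
    𝔼 w, F w = 𝔼 a, (F (a, true) + F (a, false)) / 2 := by
  rw [← univ_product_univ, expect_product]
  refine expect_congr rfl fun a _ => ?_
  rw [Fintype.expect_eq_sum_div_card]
  simp

/-- Contraction for a single random sign: a `1`-Lipschitz function may be removed. -/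
lemma iSup_add_iSup_contraction {T : Type*} [Finite T] [Nonempty T] {φ : ℝ → ℝ}
    (hφ : ∀ x y, |φ x - φ y| ≤ |x - y|) (b h : T → ℝ) :
    (⨆ τ, (b τ + 2 * φ (h τ))) + (⨆ τ, (b τ - 2 * φ (h τ))) ≤
      (⨆ τ, (b τ + 2 * h τ)) + ⨆ τ, (b τ - 2 * h τ) := by
  obtain ⟨τ, hτ⟩ := exists_eq_ciSup_of_finite (f := fun τ => b τ + 2 * φ (h τ))
  obtain ⟨τ', hτ'⟩ := exists_eq_ciSup_of_finite (f := fun τ => b τ - 2 * φ (h τ))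
  rw [← hτ, ← hτ']
  have h1 := le_iSup_of_finite (fun τ => b τ + 2 * h τ)
  have h2 := le_iSup_of_finite (fun τ => b τ - 2 * h τ)
  have h3 := (le_abs_self _).trans (hφ (h τ) (h τ'))
  -- The two maximizers are tested in the suprema on the right, in the same or in exchanged roles
  -- according to the sign of `h τ - h τ'`.
  rcases abs_cases (h τ - h τ') with h4 | h4
  · linarith [h1 τ, h2 τ']
  · linarith [h1 τ', h2 τ]

/-- Symmetrization and contraction for one random coordinate. -/
lemma expect_iSup_centered_le {T Ω : Type*} [Finite T] [Nonempty T] [Fintype Ω] [Nonempty Ω]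
    {φ : ℝ → ℝ} (hφ : ∀ x y, |φ x - φ y| ≤ |x - y|) (b : T → ℝ) (h : T → Ω → ℝ) :
    𝔼 a, ⨆ τ, (b τ + (φ (h τ a) - 𝔼 a', φ (h τ a'))) ≤
      𝔼 w : Ω × Bool, ⨆ τ, (b τ + 2 * sgn w.2 * h τ w.1) := by
  -- The mean is an average over an independent copy `a'`. Giving half of `b` to each copy separates
  -- the suprema and produces the factor 2.
  have key : ∀ a, (⨆ τ, (b τ + (φ (h τ a) - 𝔼 a', φ (h τ a')))) ≤
      (⨆ τ, (b τ + 2 * φ (h τ a))) / 2 + (𝔼 a', ⨆ τ, (b τ - 2 * φ (h τ a'))) / 2 := by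
    intro a
    refine ciSup_le fun τ => ?_
    have h1 := le_iSup_of_finite (fun τ => b τ + 2 * φ (h τ a)) τ
    have h2 : 𝔼 a', (b τ - 2 * φ (h τ a')) ≤ 𝔼 a', ⨆ τ, (b τ - 2 * φ (h τ a')) :=
      expect_le_expect fun a' _ => le_iSup_of_finite (fun τ => b τ - 2 * φ (h τ a')) τ
    rw [expect_sub_distrib, Fintype.expect_const, ← mul_expect] at h2
    linarith
  calc _ ≤ 𝔼 a, ((⨆ τ, (b τ + 2 * φ (h τ a))) / 2 +
        (𝔼 a', ⨆ τ, (b τ - 2 * φ (h τ a'))) / 2) := expect_le_expect fun a _ => key a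
    _ = 𝔼 a, ((⨆ τ, (b τ + 2 * φ (h τ a))) + (⨆ τ, (b τ - 2 * φ (h τ a)))) / 2 := by
        rw [expect_add_distrib, Fintype.expect_const, ← expect_div, ← expect_div,
          expect_add_distrib, add_div]
    _ ≤ 𝔼 a, ((⨆ τ, (b τ + 2 * h τ a)) + (⨆ τ, (b τ - 2 * h τ a))) / 2 :=
        expect_le_expect fun a _ => by
          have := iSup_add_iSup_contraction hφ b (fun τ => h τ a)
          linarith
    _ = _ := by
        rw [expect_prod_bool]
        simp [sgn, sub_eq_add_neg]

/-- Symmetrization and contraction for independent random coordinates. -/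
lemma expect_iSup_sum_centered_le {T Ω : Type*} [Finite T] [Nonempty T] [Fintype Ω] [Nonempty Ω]
    {φ : ℝ → ℝ} (hφ : ∀ x y, |φ x - φ y| ≤ |x - y|) (n : ℕ) (b : T → ℝ)
    (h : T → Fin n → Ω → ℝ) :
    𝔼 z : Fin n → Ω, ⨆ τ, (b τ + ∑ r, (φ (h τ r (z r)) - 𝔼 a, φ (h τ r a))) ≤
      𝔼 w : Fin n → Ω × Bool, ⨆ τ, (b τ + ∑ r, 2 * sgn (w r).2 * h τ r (w r).1) := by
  -- `b` must vary: it first absorbs the centred term of coordinate 0, and then the symmetrized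
  -- terms of all the others.
  induction n generalizing b with
  | zero => simp
  | succ n ih =>
    rw [expect_fin_cons, expect_fin_cons]
    calc _ ≤ 𝔼 a, 𝔼 w : Fin n → Ω × Bool, ⨆ τ,
          ((b τ + ∑ r, 2 * sgn (w r).2 * h τ r.succ (w r).1) +
            (φ (h τ 0 a) - 𝔼 a', φ (h τ 0 a'))) := by
          refine expect_le_expect fun a _ => ?_
          refine le_of_eq_of_le ?_ ((ih (fun τ => b τ + (φ (h τ 0 a) - 𝔼 a', φ (h τ 0 a')))
            (fun τ r => h τ r.succ)).trans_eq ?_)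
          · simp only [Fin.sum_univ_succ, Fin.cons_zero, Fin.cons_succ, add_assoc]
          · simp only [add_right_comm]
      _ = 𝔼 w : Fin n → Ω × Bool, 𝔼 a, ⨆ τ,
          ((b τ + ∑ r, 2 * sgn (w r).2 * h τ r.succ (w r).1) +
            (φ (h τ 0 a) - 𝔼 a', φ (h τ 0 a'))) := expect_comm _ _ _
      _ ≤ 𝔼 w : Fin n → Ω × Bool, 𝔼 v : Ω × Bool, ⨆ τ,
          ((b τ + ∑ r, 2 * sgn (w r).2 * h τ r.succ (w r).1) + 2 * sgn v.2 * h τ 0 v.1) :=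
          expect_le_expect fun w _ => expect_iSup_centered_le hφ _ _
      _ = _ := by
          rw [expect_comm]
          simp only [Fin.sum_univ_succ, Fin.cons_zero, Fin.cons_succ]
          simp only [← add_assoc, add_right_comm]

/-- Subadditivity of the supremum splits off the means; symmetrization and contraction treat the
centred rest and remove `φ`. -/
lemma expect_iSup_sum_le {T Ω : Type*} [Finite T] [Nonempty T] [Fintype Ω] [Nonempty Ω]
    {φ : ℝ → ℝ} (hφ : ∀ x y, |φ x - φ y| ≤ |x - y|) (n : ℕ) (h : T → Fin n → Ω → ℝ) :
    𝔼 z : Fin n → Ω, ⨆ τ, ∑ r, φ (h τ r (z r)) ≤ (⨆ τ, ∑ r, 𝔼 a, φ (h τ r a)) +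
      𝔼 w : Fin n → Ω × Bool, ⨆ τ, ∑ r, 2 * sgn (w r).2 * h τ r (w r).1 := by
  have := expect_iSup_sum_centered_le hφ n 0 h
  simp only [Pi.zero_apply, zero_add] at this
  refine le_trans ?_ (add_le_add le_rfl this)
  rw [← Fintype.expect_const (ι := Fin n → Ω) (⨆ τ, ∑ r, 𝔼 a, φ (h τ r a)), ← expect_add_distrib]
  refine expect_le_expect fun z _ => ciSup_le fun τ => ?_
  have h1 := le_iSup_of_finite (fun τ => ∑ r, 𝔼 a, φ (h τ r a)) τ
  have h2 := le_iSup_of_finite (fun τ => ∑ r, (φ (h τ r (z r)) - 𝔼 a, φ (h τ r a))) τ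
  rw [sum_sub_distrib] at h2
  linarith

/-- Averaging over the signs kills the cross terms. -/
lemma expect_sq_sum_sgn_le {Ω : Type*} [Fintype Ω] [Nonempty Ω] (n : ℕ) (c : ℝ)
    (g : Fin n → Ω → ℝ) (hg : ∀ r a, |g r a| ≤ c) :
    𝔼 w : Fin n → Ω × Bool, (∑ r, sgn (w r).2 * g r (w r).1) ^ 2 ≤ n * c ^ 2 := by
  induction n with
  | zero => simp
  | succ n ih =>
    have ih := ih (fun r => g r.succ) fun r => hg r.succ
    rw [expect_fin_cons, expect_comm]
    calc _ = 𝔼 w : Fin n → Ω × Bool, 𝔼 a,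
          (g 0 a ^ 2 + (∑ r, sgn (w r).2 * g r.succ (w r).1) ^ 2) := by
          refine expect_congr rfl fun w _ => ?_
          rw [expect_prod_bool]
          refine expect_congr rfl fun a _ => ?_
          simp only [Fin.sum_univ_succ, Fin.cons_zero, Fin.cons_succ, sgn, cond_true, cond_false]
          ring
      _ ≤ 𝔼 w : Fin n → Ω × Bool, (c ^ 2 + (∑ r, sgn (w r).2 * g r.succ (w r).1) ^ 2) := by
          refine expect_le_expect fun w _ => expect_le univ_nonempty fun a _ => ?_
          refine add_le_add ?_ le_rfl
          exact sq_le_sq.2 ((hg 0 a).trans (le_abs_self c))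
      _ ≤ _ := by
          rw [expect_add_distrib, Fintype.expect_const]
          push_cast
          linarith

lemma expect_abs_sum_sgn_le {Ω : Type*} [Fintype Ω] [Nonempty Ω] (n : ℕ) {c : ℝ} (hc : 0 ≤ c)
    (g : Fin n → Ω → ℝ) (hg : ∀ r a, |g r a| ≤ c) :
    𝔼 w : Fin n → Ω × Bool, |∑ r, sgn (w r).2 * g r (w r).1| ≤ c * √n := by
  set F : (Fin n → Ω × Bool) → ℝ := fun w => |∑ r, sgn (w r).2 * g r (w r).1|
  -- Nonnegativity of the variance bounds the first moment by the second.
  have h0 : 0 ≤ 𝔼 w, (F w - 𝔼 w, F w) ^ 2 := expect_nonneg fun _ _ => sq_nonneg _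
  have h1 : 𝔼 w, F w ^ 2 ≤ n * c ^ 2 := by
    simpa [F, sq_abs] using expect_sq_sum_sgn_le n c g hg
  have h2 : 𝔼 w, (F w - 𝔼 w, F w) ^ 2 = 𝔼 w, F w ^ 2 - (𝔼 w, F w) ^ 2 := by
    generalize hm : 𝔼 w, F w = m
    have : ∀ w, (F w - m) ^ 2 = F w ^ 2 - 2 * m * F w + m ^ 2 := fun w => by ring
    simp only [this, expect_add_distrib, expect_sub_distrib, Fintype.expect_const, ← mul_expect, hm]
    ring
  refine abs_le_of_sq_le_sq ?_ (by positivity) |> fun h => (abs_le.1 h).2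
  rw [mul_pow, Real.sq_sqrt (Nat.cast_nonneg n)]
  linarith

/-! ### The cut norm, and its behaviour under sampling one element per row. -/

section Cut

variable {V : Type}

/-- The total weight of `f` on `A × B`. -/
def rectSum (f : V → V → ℝ) (A B : Finset V) : ℝ := ∑ x ∈ A, ∑ y ∈ B, f x y

/-- The cut norm of `f` on `A × B`. -/
def cut (f : V → V → ℝ) (A B : Finset V) : ℝ :=
  (A.powerset ×ˢ B.powerset).sup' ((Finset.powerset_nonempty A).product (Finset.powerset_nonempty B))
    fun p => |rectSum f p.1 p.2|

lemma abs_rectSum_le_cut (f : V → V → ℝ) {A B U W : Finset V} (hU : U ⊆ A) (hW : W ⊆ B) :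
    |rectSum f U W| ≤ cut f A B :=
  le_sup' (fun p : Finset V × Finset V => |rectSum f p.1 p.2|)
    (mem_product.2 ⟨mem_powerset.2 hU, mem_powerset.2 hW⟩ : (U, W) ∈ _)

lemma cut_le {f : V → V → ℝ} {A B : Finset V} {c : ℝ}
    (h : ∀ U ⊆ A, ∀ W ⊆ B, |rectSum f U W| ≤ c) : cut f A B ≤ c := by
  refine sup'_le _ _ fun p hp => ?_
  rw [mem_product, mem_powerset, mem_powerset] at hp
  exact h _ hp.1 _ hp.2

lemma cut_nonneg (f : V → V → ℝ) (A B : Finset V) : 0 ≤ cut f A B :=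
  (abs_nonneg _).trans (abs_rectSum_le_cut f (Subset.refl A) (Subset.refl B))

lemma cut_mono (f : V → V → ℝ) {A B A' B' : Finset V} (hA : A ⊆ A') (hB : B ⊆ B') :
    cut f A B ≤ cut f A' B' :=
  cut_le fun _ hU _ hW => abs_rectSum_le_cut f (hU.trans hA) (hW.trans hB)

lemma rectSum_swap (f : V → V → ℝ) (A B : Finset V) :
    rectSum (fun x y => f y x) B A = rectSum f A B := sum_comm

lemma cut_swap (f : V → V → ℝ) (A B : Finset V) : cut (fun x y => f y x) B A = cut f A B :=
  le_antisymm (cut_le fun U hU W hW => by rw [rectSum_swap f]; exact abs_rectSum_le_cut f hW hU)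
    (cut_le fun U hU W hW => by
      rw [← rectSum_swap f]; exact abs_rectSum_le_cut (fun x y => f y x) hW hU)

lemma rectSum_eq_sum_right (f : V → V → ℝ) (A B : Finset V) :
    rectSum f A B = ∑ y ∈ B, ∑ x ∈ A, f x y := sum_comm

lemma abs_rectSum_le {f : V → V → ℝ} (hf : ∀ x y, |f x y| ≤ 1) (A B : Finset V) :
    |rectSum f A B| ≤ #A * #B := by
  refine (abs_sum_le_sum_abs _ _).trans ((sum_le_card_nsmul _ _ _ fun x _ =>
    (abs_sum_le_sum_abs _ _).trans (sum_le_card_nsmul _ _ _ fun y _ => hf x y)).trans ?_)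
  simp

lemma cut_le_mul_card {f : V → V → ℝ} (hf : ∀ x y, |f x y| ≤ 1) (A B : Finset V) :
    cut f A B ≤ #A * #B :=
  cut_le fun U hU W hW => (abs_rectSum_le hf U W).trans (by
    have := card_le_card hU
    have := card_le_card hW
    gcongr)

/-- Removing part of a rectangle changes its weight by at most the number of pairs removed. -/
lemma abs_rectSum_sub_le [DecidableEq V] {f : V → V → ℝ} (hf : ∀ x y, |f x y| ≤ 1)
    {A B A' B' : Finset V} (hA : A ⊆ A') (hB : B ⊆ B') :
    |rectSum f A' B' - rectSum f A B| ≤ (#A' * #B' - #A * #B : ℝ) := by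
  have h : ∀ g : V → V → ℝ, rectSum g A' B' - rectSum g A B =
      ∑ p ∈ (A' ×ˢ B') \ (A ×ˢ B), g p.1 p.2 := fun g => by
    rw [rectSum, rectSum, ← sum_product', ← sum_product',
      ← sum_sdiff (product_subset_product hA hB)]
    ring
  have h1 := h fun _ _ => 1
  simp only [rectSum, sum_const, nsmul_eq_mul, mul_one] at h1
  rw [h, h1]
  refine (abs_sum_le_sum_abs _ _).trans ((sum_le_card_nsmul _ _ 1 fun p _ => hf _ _).trans ?_)
  simp

/-- Restricting a rectangle changes its cut norm by at most the number of pairs removed. -/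
lemma cut_le_cut_add [DecidableEq V] {f : V → V → ℝ} (hf : ∀ x y, |f x y| ≤ 1)
    {A B A' B' : Finset V} (hA : A ⊆ A') (hB : B ⊆ B') :
    cut f A' B' ≤ cut f A B + (#A' * #B' - #A * #B : ℝ) := by
  refine cut_le fun U hU W hW => ?_
  have h1 := abs_rectSum_sub_le hf (inter_subset_left (s₁ := U) (s₂ := A))
    (inter_subset_left (s₁ := W) (s₂ := B))
  have h2 := abs_rectSum_le_cut f (inter_subset_right (s₁ := U) (s₂ := A))
    (inter_subset_right (s₁ := W) (s₂ := B))
  have h3 : (#U * #W - #(U ∩ A) * #(W ∩ B) : ℝ) ≤ #A' * #B' - #A * #B := by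
    have e1 : (#(U \ A) : ℝ) ≤ #(A' \ A) := by
      exact_mod_cast card_le_card (sdiff_subset_sdiff hU le_rfl)
    have e2 : (#(W \ B) : ℝ) ≤ #(B' \ B) := by
      exact_mod_cast card_le_card (sdiff_subset_sdiff hW le_rfl)
    have e3 : (#(U ∩ A) : ℝ) ≤ #A := by exact_mod_cast card_le_card inter_subset_right
    have e4 : (#(W ∩ B) : ℝ) ≤ #B := by exact_mod_cast card_le_card inter_subset_right
    have f1 : (#U : ℝ) = #(U ∩ A) + #(U \ A) := by
      exact_mod_cast (card_inter_add_card_sdiff U A).symm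
    have f2 : (#W : ℝ) = #(W ∩ B) + #(W \ B) := by
      exact_mod_cast (card_inter_add_card_sdiff W B).symm
    have f3 : (#A' : ℝ) = #A + #(A' \ A) := by
      rw [add_comm]; exact_mod_cast (card_sdiff_add_card_eq_card hA).symm
    have f4 : (#B' : ℝ) = #B + #(B' \ B) := by
      rw [add_comm]; exact_mod_cast (card_sdiff_add_card_eq_card hB).symm
    rw [f1, f2, f3, f4]
    have g1 : (#(U ∩ A) : ℝ) * #(W \ B) ≤ #A * #(B' \ B) := by gcongr
    have g2 : (#(U \ A) : ℝ) * #(W ∩ B) ≤ #(A' \ A) * #B := by gcongr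
    have g3 : (#(U \ A) : ℝ) * #(W \ B) ≤ #(A' \ A) * #(B' \ B) := by gcongr
    linarith
  have := abs_sub_abs_le_abs_sub (rectSum f U W) (rectSum f (U ∩ A) (W ∩ B))
  linarith

lemma max_zero_lipschitz (x y : ℝ) : |max x 0 - max y 0| ≤ |x - y| :=
  abs_max_sub_max_le_abs x y 0

/-- For fixed `U` and sign, the best `W` consists of the columns with positive signed sum. Together
with `cut_le_iSup` this removes `W`: the cut norm is a supremum of sums over `B` of a 1-Lipschitz
function of column sums, the form that contraction requires. -/
lemma sum_max_zero_le_cut (f : V → V → ℝ) {A U : Finset V} (B : Finset V) (hU : U ⊆ A) (s : Bool) :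
    ∑ y ∈ B, max (sgn s * ∑ x ∈ U, f x y) 0 ≤ cut f A B := by
  classical
  have : ∑ y ∈ B, max (sgn s * ∑ x ∈ U, f x y) 0 =
      sgn s * rectSum f U (B.filter fun y => 0 < sgn s * ∑ x ∈ U, f x y) := by
    rw [rectSum_eq_sum_right, mul_sum, sum_filter]
    refine sum_congr rfl fun y _ => ?_
    split_ifs with h
    · exact max_eq_left h.le
    · exact max_eq_right (not_lt.1 h)
  rw [this]
  refine (le_abs_self _).trans ?_
  rw [abs_mul, abs_sgn, one_mul]
  exact abs_rectSum_le_cut f hU (filter_subset _ _)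

lemma cut_le_iSup (f : V → V → ℝ) (A B : Finset V) :
    cut f A B ≤ ⨆ τ : Bool × A.powerset, ∑ y ∈ B, max (sgn τ.1 * ∑ x ∈ τ.2.1, f x y) 0 := by
  refine cut_le fun U hU W hW => ?_
  have key : ∀ s : Bool, sgn s * rectSum f U W ≤
      ⨆ τ : Bool × A.powerset, ∑ y ∈ B, max (sgn τ.1 * ∑ x ∈ τ.2.1, f x y) 0 := fun s => by
    refine le_trans ?_ (le_iSup_of_finite (fun τ : Bool × A.powerset =>
      ∑ y ∈ B, max (sgn τ.1 * ∑ x ∈ τ.2.1, f x y) 0) (s, ⟨U, mem_powerset.2 hU⟩))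
    rw [rectSum_eq_sum_right, mul_sum]
    exact (sum_le_sum fun y _ => le_max_left _ _).trans
      (sum_le_sum_of_subset_of_nonneg hW fun _ _ _ => le_max_right _ _)
  refine abs_le'.2 ⟨?_, ?_⟩
  · simpa [sgn] using key true
  · simpa [sgn] using key false

variable {Ω : Type*}

lemma sum_image_row [DecidableEq V] {t : ℕ} {g : Fin t → Ω → V}
    (hg : Function.Injective fun p : Fin t × Ω => g p.1 p.2)
    (z : Fin t → Ω) (F : V → ℝ) :
    ∑ y ∈ univ.image (fun r => g r (z r)), F y = ∑ r, F (g r (z r)) :=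
  sum_image fun r _ r' _ h => congrArg Prod.fst (@hg (r, z r) (r', z r') h)

lemma sum_image_total [Fintype Ω] [DecidableEq V] {t : ℕ} {g : Fin t → Ω → V}
    (hg : Function.Injective fun p : Fin t × Ω => g p.1 p.2) (F : V → ℝ) :
    ∑ y ∈ univ.image (fun p : Fin t × Ω => g p.1 p.2), F y =
      Fintype.card Ω * ∑ r, 𝔼 a, F (g r a) := by
  rw [sum_image fun _ _ _ _ h => hg h, ← univ_product_univ, sum_product, mul_sum]
  exact sum_congr rfl fun r _ => (Fintype.card_mul_expect _).symm

lemma expect_sum_abs_sgn_le [Fintype Ω] [Nonempty Ω]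
    {f : V → V → ℝ} (hf : ∀ x y, |f x y| ≤ 1) (A : Finset V) {t : ℕ}
    (g : Fin t → Ω → V) :
    𝔼 w : Fin t → Ω × Bool, ∑ x ∈ A, |∑ r, sgn (w r).2 * f x (g r (w r).1)| ≤ #A * √t := by
  rw [expect_sum_comm]
  refine (sum_le_card_nsmul _ _ (1 * √t) fun x _ => ?_).trans (by simp)
  exact expect_abs_sum_sgn_le t zero_le_one (fun r a => f x (g r a)) fun r a => hf _ _

/-- Sampling one element of each row: the cut norm is at most its expected share, up to an error
of the order of the square root of the number of rows. -/
lemma expect_cut_right_le [Fintype Ω] [Nonempty Ω] [DecidableEq V]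
    {f : V → V → ℝ} (hf : ∀ x y, |f x y| ≤ 1) (A : Finset V) {t : ℕ}
    {g : Fin t → Ω → V} (hg : Function.Injective fun p : Fin t × Ω => g p.1 p.2) :
    𝔼 z : Fin t → Ω, cut f A (univ.image fun r => g r (z r)) ≤
      cut f A (univ.image fun p : Fin t × Ω => g p.1 p.2) / Fintype.card Ω + 2 * #A * √t := by
  have hΩ : (0 : ℝ) < Fintype.card Ω := by exact_mod_cast Fintype.card_pos
  have : Nonempty (A.powerset) := ⟨⟨∅, empty_mem_powerset A⟩⟩
  have h := expect_iSup_sum_le (T := Bool × A.powerset) max_zero_lipschitz t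
    (fun τ r (a : Ω) => sgn τ.1 * ∑ x ∈ τ.2.1, f x (g r a))
  calc _ ≤ 𝔼 z : Fin t → Ω, ⨆ τ : Bool × A.powerset,
        ∑ r, max (sgn τ.1 * ∑ x ∈ τ.2.1, f x (g r (z r))) 0 := by
        refine expect_le_expect fun z _ => (cut_le_iSup _ _ _).trans_eq ?_
        simp only [sum_image_row hg]
    _ ≤ _ := h.trans (add_le_add (ciSup_le fun τ => ?_) ?_)
  · rw [le_div_iff₀' hΩ, ← sum_image_total hg (fun y => max (sgn τ.1 * ∑ x ∈ τ.2.1, f x y) 0)]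
    exact sum_max_zero_le_cut f _ (mem_powerset.1 τ.2.2) _
  -- Once the positive part is gone, the expression is linear in the indicator of `U`, so the
  -- supremum is at most a sum over `x ∈ A` of absolute values of sign sums.
  · calc _ ≤ 𝔼 w : Fin t → Ω × Bool, 2 * ∑ x ∈ A, |∑ r, sgn (w r).2 * f x (g r (w r).1)| := by
          refine expect_le_expect fun w _ => ciSup_le fun τ => ?_
          have : ∑ r, 2 * sgn (w r).2 * (sgn τ.1 * ∑ x ∈ τ.2.1, f x (g r (w r).1)) =
              2 * (sgn τ.1 * ∑ x ∈ τ.2.1, ∑ r, sgn (w r).2 * f x (g r (w r).1)) := by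
            rw [sum_comm, mul_sum, mul_sum]
            refine sum_congr rfl fun r _ => ?_
            rw [← mul_sum]
            ring
          rw [this]
          gcongr
          refine (le_abs_self _).trans ?_
          rw [abs_mul, abs_sgn, one_mul]
          exact (abs_sum_le_sum_abs _ _).trans (sum_le_sum_of_subset_of_nonneg
            (mem_powerset.1 τ.2.2) fun _ _ _ => abs_nonneg _)
      _ ≤ _ := by
          rw [← mul_expect]
          linarith [expect_sum_abs_sgn_le hf A g]

/-- The total weight needs its own estimate: bounding it by the cut norm would double the original
irregularity in the end, whereas the total weight of the deviation on a pair of original parts is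
zero. -/
lemma expect_abs_rectSum_right_le [Fintype Ω] [Nonempty Ω] [DecidableEq V]
    {f : V → V → ℝ} (hf : ∀ x y, |f x y| ≤ 1) (A : Finset V) {t : ℕ}
    {g : Fin t → Ω → V} (hg : Function.Injective fun p : Fin t × Ω => g p.1 p.2) :
    𝔼 z : Fin t → Ω, |rectSum f A (univ.image fun r => g r (z r))| ≤
      |rectSum f A (univ.image fun p : Fin t × Ω => g p.1 p.2)| / Fintype.card Ω +
        2 * #A * √t := by
  have hΩ : (0 : ℝ) < Fintype.card Ω := by exact_mod_cast Fintype.card_pos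
  have h := expect_iSup_sum_le (T := Bool) (φ := id) (fun _ _ => le_rfl) t
    (fun s r (a : Ω) => sgn s * ∑ x ∈ A, f x (g r a))
  simp only [id] at h
  calc _ ≤ 𝔼 z : Fin t → Ω, ⨆ s : Bool, ∑ r, sgn s * ∑ x ∈ A, f x (g r (z r)) := by
        refine expect_le_expect fun z _ => ?_
        rw [rectSum_eq_sum_right, sum_image_row hg z fun y => ∑ x ∈ A, f x y]
        have := le_iSup_of_finite (fun s : Bool => ∑ r, sgn s * ∑ x ∈ A, f x (g r (z r)))
        refine abs_le'.2 ⟨?_, ?_⟩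
        · simpa [sgn] using this true
        · simpa [sgn] using this false
    _ ≤ _ := h.trans (add_le_add (ciSup_le fun s => ?_) ?_)
  · rw [le_div_iff₀' hΩ, rectSum_eq_sum_right, sum_image_total hg fun y => ∑ x ∈ A, f x y]
    simp only [← mul_expect, ← mul_sum]
    rw [mul_left_comm]
    refine (le_abs_self _).trans ?_
    rw [abs_mul, abs_sgn, one_mul]
  · calc _ ≤ 𝔼 w : Fin t → Ω × Bool, 2 * |∑ r, sgn (w r).2 * ∑ x ∈ A, f x (g r (w r).1)| := by
          refine expect_le_expect fun w _ => ciSup_le fun s => ?_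
          have : ∑ r, 2 * sgn (w r).2 * (sgn s * ∑ x ∈ A, f x (g r (w r).1)) =
              2 * (sgn s * ∑ r, sgn (w r).2 * ∑ x ∈ A, f x (g r (w r).1)) := by
            rw [mul_sum, mul_sum]
            exact sum_congr rfl fun r _ => by ring
          rw [this]
          gcongr
          refine (le_abs_self _).trans ?_
          rw [abs_mul, abs_sgn, one_mul]
      _ ≤ _ := by
          rw [← mul_expect, mul_assoc]
          gcongr
          refine expect_abs_sum_sgn_le t (Nat.cast_nonneg _)
            (fun r a => ∑ x ∈ A, f x (g r a)) fun r a => ?_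
          exact (abs_sum_le_sum_abs _ _).trans
            ((sum_le_card_nsmul _ _ 1 fun x _ => hf _ _).trans (by simp))

lemma expect_cut_left_le [Fintype Ω] [Nonempty Ω] [DecidableEq V]
    {f : V → V → ℝ} (hf : ∀ x y, |f x y| ≤ 1) (B : Finset V) {t : ℕ}
    {g : Fin t → Ω → V} (hg : Function.Injective fun p : Fin t × Ω => g p.1 p.2) :
    𝔼 z : Fin t → Ω, cut f (univ.image fun r => g r (z r)) B ≤
      cut f (univ.image fun p : Fin t × Ω => g p.1 p.2) B / Fintype.card Ω + 2 * #B * √t := by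
  simp only [← cut_swap f]
  exact expect_cut_right_le (fun x y => hf y x) B hg

lemma expect_abs_rectSum_left_le [Fintype Ω] [Nonempty Ω] [DecidableEq V]
    {f : V → V → ℝ} (hf : ∀ x y, |f x y| ≤ 1) (B : Finset V) {t : ℕ}
    {g : Fin t → Ω → V} (hg : Function.Injective fun p : Fin t × Ω => g p.1 p.2) :
    𝔼 z : Fin t → Ω, |rectSum f (univ.image fun r => g r (z r)) B| ≤
      |rectSum f (univ.image fun p : Fin t × Ω => g p.1 p.2) B| / Fintype.card Ω +
        2 * #B * √t := by
  simp only [← rectSum_swap f]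
  exact expect_abs_rectSum_right_le (fun x y => hf y x) B hg

end Cut

/-! ### Random blocks from class-preserving permutations of the rows. -/

section Blocks

variable {V ι κ : Type} [DecidableEq V] {t : ℕ}

/-- The block formed by the vertices `e (v r) r`, one for each row `r`. -/
def block (e : ι → Fin t → V) (v : Fin t → ι) : Finset V := univ.image fun r => e (v r) r

lemma card_block_le (e : ι → Fin t → V) (v : Fin t → ι) : #(block e v) ≤ t :=
  card_image_le.trans (by simp)

lemma card_block {e : ι → Fin t → V} (he : Function.Injective fun p : ι × Fin t => e p.1 p.2)
    (v : Fin t → ι) : #(block e v) = t := by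
  rw [block, card_image_of_injective, card_univ, Fintype.card_fin]
  exact fun r r' h => congrArg Prod.snd (@he (v r, r) (v r', r') h)

/-- The permutations of the index set preserving the classes of `cl`. -/
def classPerm (cl : ι → κ) : Subgroup (Equiv.Perm ι) where
  carrier := {σ | ∀ p, cl (σ p) = cl p}
  mul_mem' {σ τ} hσ hτ p := (hσ (τ p)).trans (hτ p)
  one_mem' _ := rfl
  inv_mem' {σ} hσ p := by simpa using (hσ (σ⁻¹ p)).symm

variable [Fintype ι]

instance (cl : ι → κ) : Fintype (classPerm cl) := Fintype.ofFinite _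

variable [DecidableEq ι]

/-- The transposition of two indices of the same class. -/
def classSwap (cl : ι → κ) {p q : ι} (h : cl q = cl p) : classPerm cl :=
  ⟨Equiv.swap p q, fun a => by
    by_cases h1 : a = p
    · rw [h1, Equiv.swap_apply_left, h]
    · by_cases h2 : a = q
      · rw [h2, Equiv.swap_apply_right, h]
      · rw [Equiv.swap_apply_of_ne_of_ne h1 h2]⟩

/-- The random index in each row may be resampled within its class. -/
lemma expect_resample {cl : ι → κ} {S : Finset ι} {q : ι} (hS : ∀ a ∈ S, cl a = cl q)
    [Nonempty S] (F : (Fin t → classPerm cl) → ℝ) :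
    𝔼 ω, F ω = 𝔼 ω : Fin t → classPerm cl, 𝔼 z : Fin t → S,
      F (fun r => ω r * classSwap cl (hS _ (z r).2)) := by
  rw [expect_comm]
  rw [← Fintype.expect_const (ι := Fin t → S) (𝔼 ω, F ω)]
  refine expect_congr rfl fun z _ => ?_
  -- For fixed `z` this is a right translation of the group of samples, hence a bijection;
  -- afterwards position `q` of row `r` holds `ω r (z r)`.
  exact (Fintype.expect_equiv (Equiv.mulRight fun r => classSwap cl (hS _ (z r).2)) _ _
    fun ω => rfl).symm

variable [DecidableEq κ]

/-- The vertices in the rows of the class `y`. -/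
def core (cl : ι → κ) (e : ι → Fin t → V) (y : κ) : Finset V :=
  (univ.filter (fun a => cl a = y) ×ˢ univ).image fun p : ι × Fin t => e p.1 p.2

omit [DecidableEq ι] in
lemma card_core (cl : ι → κ) {e : ι → Fin t → V}
    (he : Function.Injective fun p : ι × Fin t => e p.1 p.2) (y : κ) :
    #(core cl e y) = #(univ.filter fun a => cl a = y) * t := by
  rw [core, card_image_of_injective _ he, card_product, card_univ, Fintype.card_fin]

section
variable {cl : ι → κ} (ω : Fin t → classPerm cl) (S : Finset ι) {e : ι → Fin t → V}

omit [DecidableEq V] [Fintype ι] [DecidableEq ι] [DecidableEq κ] in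
lemma injective_permuted_rows (he : Function.Injective fun p : ι × Fin t => e p.1 p.2) :
    Function.Injective fun p : Fin t × S => e ((ω p.1).1 p.2) p.1 := by
  rintro ⟨r, a⟩ ⟨r', a'⟩ h
  have h := @he ((ω r).1 a, r) ((ω r').1 a', r') h
  simp only [Prod.mk.injEq] at h
  obtain ⟨h1, rfl⟩ := h
  exact Prod.ext rfl (Subtype.ext ((ω r).1.injective h1))

omit [DecidableEq ι] in
lemma image_permuted_rows_subset_core {y : κ} (hS : ∀ a ∈ S, cl a = y) :
    (univ.image fun p : Fin t × S => e ((ω p.1).1 p.2) p.1) ⊆ core cl e y := by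
  intro v hv
  obtain ⟨⟨r, a⟩, -, rfl⟩ := mem_image.1 hv
  exact mem_image.2 ⟨((ω r).1 a, r), by simp [(ω r).2 a, hS a a.2], rfl⟩

-- Each `ω r` permutes the class, so the vertices available to a resampled block form the same set
-- for every `ω`.
omit [DecidableEq ι] in
lemma image_permuted_rows_class (he : Function.Injective fun p : ι × Fin t => e p.1 p.2) (y : κ) :
    (univ.image fun p : Fin t × (univ.filter fun a => cl a = y : Finset ι) =>
      e ((ω p.1).1 p.2) p.1) = core cl e y := by
  refine eq_of_subset_of_card_le (image_permuted_rows_subset_core ω _ (by simp)) ?_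
  rw [card_core cl he, card_image_of_injective _ (injective_permuted_rows ω _ he)]
  rw [card_univ, Fintype.card_prod, Fintype.card_fin, Fintype.card_coe, mul_comm]

end

section
variable (cl : ι → κ) {e : ι → Fin t → V} (he : Function.Injective fun p : ι × Fin t => e p.1 p.2)
  {f : V → V → ℝ} (hf : ∀ x y, |f x y| ≤ 1)

include he hf

lemma expect_cut_block_left_le (p : ι) (B : Finset V) :
    𝔼 ω : Fin t → classPerm cl, cut f (block e fun r => (ω r).1 p) B ≤
      cut f (core cl e (cl p)) B / #(univ.filter fun a => cl a = cl p) + 2 * #B * √t := by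
  set S := univ.filter fun a => cl a = cl p
  have hS : ∀ a ∈ S, cl a = cl p := fun a ha => (mem_filter.1 ha).2
  have : Nonempty S := ⟨⟨p, by simp [S]⟩⟩
  rw [expect_resample hS]
  refine expect_le univ_nonempty fun ω _ => ?_
  have h := expect_cut_left_le (g := fun r (a : S) => e ((ω r).1 a) r) hf B
    (injective_permuted_rows ω S he)
  rw [image_permuted_rows_class ω he] at h
  simpa [classSwap, block] using h

lemma expect_abs_rectSum_block_left_le (p : ι) (B : Finset V) :
    𝔼 ω : Fin t → classPerm cl, |rectSum f (block e fun r => (ω r).1 p) B| ≤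
      |rectSum f (core cl e (cl p)) B| / #(univ.filter fun a => cl a = cl p) + 2 * #B * √t := by
  set S := univ.filter fun a => cl a = cl p
  have hS : ∀ a ∈ S, cl a = cl p := fun a ha => (mem_filter.1 ha).2
  have : Nonempty S := ⟨⟨p, by simp [S]⟩⟩
  rw [expect_resample hS]
  refine expect_le univ_nonempty fun ω _ => ?_
  have h := expect_abs_rectSum_left_le (g := fun r (a : S) => e ((ω r).1 a) r) hf B
    (injective_permuted_rows ω S he)
  rw [image_permuted_rows_class ω he] at h
  simpa [classSwap, block] using h

-- Since `q` itself survives the removal of `p`, at most half of the class is lost; this keeps the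
-- sampling error at O(t √t) after division by the smaller count.
omit he hf in
lemma card_class_le {p q : ι} (hpq : p ≠ q) :
    (#(univ.filter fun a => cl a = cl q) : ℝ) ≤ 2 * #(univ.filter fun a => cl a = cl q ∧ a ≠ p) := by
  have h0 : 1 ≤ #(univ.filter fun a => cl a = cl q ∧ a ≠ p) :=
    card_pos.2 ⟨q, by simp [hpq.symm]⟩
  have h1 : (univ.filter fun a => cl a = cl q) ⊆
      insert p (univ.filter fun a => cl a = cl q ∧ a ≠ p) := fun a ha => by
    simp only [mem_insert, mem_filter, mem_univ, true_and] at ha ⊢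
    tauto
  have h2 := (card_le_card h1).trans (card_insert_le _ _)
  exact_mod_cast (by omega : #(univ.filter fun a => cl a = cl q) ≤
    2 * #(univ.filter fun a => cl a = cl q ∧ a ≠ p))

/-- Two blocks of the same class are dependent. So `q` is resampled only among indices other than
`p`, which leaves block `p` untouched; then block `p` is resampled against the fixed core of the
class of `q`. The errors are 2 and, by `card_class_le`, 4 times `t * √t`. -/
lemma expect_cut_block_le {p q : ι} (hpq : p ≠ q) :
    𝔼 ω : Fin t → classPerm cl,
      cut f (block e fun r => (ω r).1 p) (block e fun r => (ω r).1 q) ≤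
      cut f (core cl e (cl p)) (core cl e (cl q)) / #(univ.filter fun a => cl a = cl p) /
        #(univ.filter fun a => cl a = cl q ∧ a ≠ p) + 6 * (t * √t) := by
  have hc := card_class_le cl hpq
  set S := univ.filter fun a => cl a = cl q ∧ a ≠ p with hSdef
  have hS : ∀ a ∈ S, cl a = cl q := fun a ha => (mem_filter.1 ha).2.1
  have hSp : ∀ a : S, (a : ι) ≠ p := fun a => (mem_filter.1 a.2).2.2
  have hne : Nonempty S := ⟨⟨q, by simp [S, hpq.symm]⟩⟩
  have hSpos : (0 : ℝ) < #S := by exact_mod_cast card_pos.2 (nonempty_coe_sort.1 hne)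
  rw [expect_resample hS]
  calc _ ≤ 𝔼 ω : Fin t → classPerm cl,
        (cut f (block e fun r => (ω r).1 p) (core cl e (cl q)) / #S + 2 * (t * √t)) := by
        refine expect_le_expect fun ω _ => ?_
        have h := expect_cut_right_le (g := fun r (a : S) => e ((ω r).1 a) r) hf
          (block e fun r => (ω r).1 p) (injective_permuted_rows ω S he)
        have hfix : ∀ a : S, Equiv.swap q (a : ι) p = p := fun a =>
          Equiv.swap_apply_of_ne_of_ne hpq (hSp a).symm
        simp only [classSwap, Subgroup.coe_mul, Equiv.Perm.mul_apply, hfix,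
          Equiv.swap_apply_left]
        refine h.trans ?_
        rw [Fintype.card_coe, mul_assoc 2]
        have := card_block_le e fun r => (ω r).1 p
        gcongr
        exact cut_mono f le_rfl (image_permuted_rows_subset_core ω S hS)
    _ ≤ (cut f (core cl e (cl p)) (core cl e (cl q)) / #(univ.filter fun a => cl a = cl p) +
        2 * #(core cl e (cl q)) * √t) / #S + 2 * (t * √t) := by
        rw [expect_add_distrib, Fintype.expect_const, ← expect_div]
        gcongr
        exact expect_cut_block_left_le cl he hf p _
    _ ≤ _ := by
        rw [add_div, card_core cl he, add_assoc]
        gcongr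
        have : 2 * ((#(univ.filter fun a => cl a = cl q) * t : ℕ) : ℝ) * √t / #S ≤ 4 * (t * √t) := by
          rw [div_le_iff₀ hSpos]
          push_cast
          have : 0 ≤ (t : ℝ) * √t := by positivity
          nlinarith
        linarith

/-- Unlike the cut norm, the total weight is not monotone, so enlarging the sampled set to the whole
core costs the number of added pairs; this is the middle term. -/
lemma expect_abs_rectSum_block_le {p q : ι} (hpq : p ≠ q) :
    𝔼 ω : Fin t → classPerm cl,
      |rectSum f (block e fun r => (ω r).1 p) (block e fun r => (ω r).1 q)| ≤
      |rectSum f (core cl e (cl p)) (core cl e (cl q))| / #(univ.filter fun a => cl a = cl p) /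
        #(univ.filter fun a => cl a = cl q ∧ a ≠ p) +
      (#(univ.filter fun a => cl a = cl q) - #(univ.filter fun a => cl a = cl q ∧ a ≠ p)) *
        (t : ℝ) ^ 2 / #(univ.filter fun a => cl a = cl q ∧ a ≠ p) + 6 * (t * √t) := by
  have hc := card_class_le cl hpq
  set S := univ.filter fun a => cl a = cl q ∧ a ≠ p with hSdef
  set Q := univ.filter fun a => cl a = cl q with hQdef
  have hS : ∀ a ∈ S, cl a = cl q := fun a ha => (mem_filter.1 ha).2.1
  have hSp : ∀ a : S, (a : ι) ≠ p := fun a => (mem_filter.1 a.2).2.2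
  have hne : Nonempty S := ⟨⟨q, by simp [S, hpq.symm]⟩⟩
  have hSpos : (0 : ℝ) < #S := by exact_mod_cast card_pos.2 (nonempty_coe_sort.1 hne)
  have hSQ : (#S : ℝ) ≤ #Q := by
    exact_mod_cast card_le_card fun a ha => mem_filter.2 ⟨mem_univ _, hS a ha⟩
  rw [expect_resample hS]
  calc _ ≤ 𝔼 ω : Fin t → classPerm cl,
        ((|rectSum f (block e fun r => (ω r).1 p) (core cl e (cl q))| + (#Q - #S) * (t : ℝ) ^ 2)
          / #S + 2 * (t * √t)) := by
        refine expect_le_expect fun ω _ => ?_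
        have h := expect_abs_rectSum_right_le (g := fun r (a : S) => e ((ω r).1 a) r) hf
          (block e fun r => (ω r).1 p) (injective_permuted_rows ω S he)
        have hfix : ∀ a : S, Equiv.swap q (a : ι) p = p := fun a =>
          Equiv.swap_apply_of_ne_of_ne hpq (hSp a).symm
        simp only [classSwap, Subgroup.coe_mul, Equiv.Perm.mul_apply, hfix,
          Equiv.swap_apply_left]
        refine h.trans ?_
        rw [Fintype.card_coe, mul_assoc 2]
        have hb := card_block_le e fun r => (ω r).1 p
        gcongr
        have h1 := abs_rectSum_sub_le hf (Subset.refl (block e fun r => (ω r).1 p))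
          (image_permuted_rows_subset_core (e := e) ω S hS)
        have h2 := abs_sub_abs_le_abs_sub
          (rectSum f (block e fun r => (ω r).1 p)
            (univ.image fun p : Fin t × S => e ((ω p.1).1 p.2) p.1))
          (rectSum f (block e fun r => (ω r).1 p) (core cl e (cl q)))
        rw [abs_sub_comm] at h2
        rw [card_core cl he, card_image_of_injective _ (injective_permuted_rows ω S he),
          card_block he] at h1
        simp only [Fintype.card_prod, Fintype.card_fin, Fintype.card_coe, card_univ] at h1
        push_cast at h1
        linarith
    _ ≤ (|rectSum f (core cl e (cl p)) (core cl e (cl q))| / #(univ.filter fun a => cl a = cl p) +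
        2 * #(core cl e (cl q)) * √t + (#Q - #S) * (t : ℝ) ^ 2) / #S + 2 * (t * √t) := by
        rw [expect_add_distrib, Fintype.expect_const, ← expect_div, expect_add_distrib,
          Fintype.expect_const]
        gcongr
        exact expect_abs_rectSum_block_left_le cl he hf p _
    _ ≤ _ := by
        rw [add_div, add_div, card_core cl he]
        have : 2 * ((#Q * t : ℕ) : ℝ) * √t / #S ≤ 4 * (t * √t) := by
          rw [div_le_iff₀ hSpos]
          push_cast
          have : 0 ≤ (t : ℝ) * √t := by positivity
          nlinarith
        linarith

end

/-- Distributing a weight on the classes evenly over their members other than `p`. -/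
lemma sum_div_card_class_le (cl : ι → κ) {Y : Finset κ} (hY : ∀ p, cl p ∈ Y) (p : ι) {c : κ → ℝ}
    (hc : ∀ y ∈ Y, 0 ≤ c y) :
    ∑ q ∈ univ.erase p, c (cl q) / #(univ.filter fun a => cl a = cl q ∧ a ≠ p) ≤ ∑ y ∈ Y, c y := by
  rw [← sum_fiberwise_of_maps_to (fun q _ => hY q)]
  refine sum_le_sum fun y hy => ?_
  have h : ∀ q ∈ (univ.erase p).filter (fun q => cl q = y),
      c (cl q) / #(univ.filter fun a => cl a = cl q ∧ a ≠ p) =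
        c y / #(univ.filter fun a => cl a = y ∧ a ≠ p) := fun q hq => by
    rw [(mem_filter.1 hq).2]
  rw [sum_congr rfl h, sum_const, nsmul_eq_mul]
  have h2 : (univ.erase p).filter (fun q => cl q = y) = univ.filter fun a => cl a = y ∧ a ≠ p := by
    ext a; simp [and_comm]
  rw [h2]
  rcases eq_or_ne (#(univ.filter fun a => cl a = y ∧ a ≠ p) : ℝ) 0 with h0 | h0
  · rw [h0, zero_mul]
    exact hc y hy
  · rw [mul_div_cancel₀ _ h0]

end Blocks

/-! ### Averaging over all pairs of blocks. -/

section Rearrangement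

variable {V ι κ : Type} [DecidableEq V] [Fintype ι] [DecidableEq ι] [DecidableEq κ] {t : ℕ}

omit [DecidableEq ι] in
/-- Distributing a weight on the classes evenly over their members. -/
lemma sum_div_card_class_eq_le (cl : ι → κ) {Y : Finset κ} (hY : ∀ p, cl p ∈ Y) {c : κ → ℝ}
    (hc : ∀ y ∈ Y, 0 ≤ c y) :
    ∑ q, c (cl q) / #(univ.filter fun a => cl a = cl q) ≤ ∑ y ∈ Y, c y := by
  rw [← sum_fiberwise_of_maps_to (fun q _ => hY q)]
  refine sum_le_sum fun y hy => ?_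
  have h : ∀ q ∈ univ.filter (fun q => cl q = y),
      c (cl q) / #(univ.filter fun a => cl a = cl q) =
        c y / #(univ.filter fun a => cl a = y) := fun q hq => by
    rw [(mem_filter.1 hq).2]
  rw [sum_congr rfl h, sum_const, nsmul_eq_mul]
  rcases eq_or_ne (#(univ.filter fun a => cl a = y) : ℝ) 0 with h0 | h0
  · rw [h0, zero_mul]
    exact hc y hy
  · rw [mul_div_cancel₀ _ h0]

/-- Only the class of `p` loses an index, so the extra total-weight terms amount to a single `t ^ 2`
for each `p`. -/
lemma sum_card_class_sub (cl : ι → κ) {Y : Finset κ} (hY : ∀ p, cl p ∈ Y) (p : ι) :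
    ∑ y ∈ Y, ((#(univ.filter fun a => cl a = y) : ℝ) - #(univ.filter fun a => cl a = y ∧ a ≠ p)) =
      1 := by
  have h1 : #(univ : Finset ι) = ∑ y ∈ Y, #(univ.filter fun a => cl a = y) :=
    card_eq_sum_card_fiberwise fun q _ => hY q
  have h2 : #(univ.erase p) = ∑ y ∈ Y, #((univ.erase p).filter fun a => cl a = y) :=
    card_eq_sum_card_fiberwise fun q _ => hY q
  have h3 : ∀ y, (univ.erase p).filter (fun a => cl a = y) =
      univ.filter fun a => cl a = y ∧ a ≠ p := fun y => by
    ext a; simp [and_comm]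
  simp only [h3] at h2
  have h4 := card_erase_add_one (mem_univ p)
  rw [sum_sub_distrib, ← Nat.cast_sum, ← Nat.cast_sum, ← h1, ← h2, ← h4]
  push_cast
  ring

/-- The blocks can be chosen so that the total cut norm over pairs of blocks is hardly larger than
the total cut norm over pairs of classes. -/
lemma exists_rearrangement (cl : ι → κ) {Y : Finset κ} (hY : ∀ p, cl p ∈ Y) {e : ι → Fin t → V}
    (he : Function.Injective fun p : ι × Fin t => e p.1 p.2) {f : κ → κ → V → V → ℝ}
    (hf : ∀ x y u v, |f x y u v| ≤ 1) :
    ∃ e' : ι → Fin t → V, (Function.Injective fun p : ι × Fin t => e' p.1 p.2) ∧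
      ∑ p, ∑ q, (cut (f (cl p) (cl q)) (univ.image (e' p)) (univ.image (e' q)) +
        |rectSum (f (cl p) (cl q)) (univ.image (e' p)) (univ.image (e' q))|) ≤
      ∑ x ∈ Y, ∑ y ∈ Y, (cut (f x y) (core cl e x) (core cl e y) +
        |rectSum (f x y) (core cl e x) (core cl e y)|) +
        3 * Fintype.card ι * (t : ℝ) ^ 2 + 12 * (Fintype.card ι : ℝ) ^ 2 * (t * √t) := by
  set c : κ → κ → ℝ := fun x y => cut (f x y) (core cl e x) (core cl e y) +
    |rectSum (f x y) (core cl e x) (core cl e y)| with hc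
  have hc0 : ∀ x y, 0 ≤ c x y := fun x y => add_nonneg (cut_nonneg _ _ _) (abs_nonneg _)
  set J : (Fin t → classPerm cl) → ι → ι → ℝ := fun ω p q =>
    cut (f (cl p) (cl q)) (block e fun r => (ω r).1 p) (block e fun r => (ω r).1 q) +
      |rectSum (f (cl p) (cl q)) (block e fun r => (ω r).1 p) (block e fun r => (ω r).1 q)| with hJ
  set T : ℝ := t * √t
  have hT : 0 ≤ T := by positivity
  have hdiag : ∀ ω p, J ω p p ≤ 2 * (t : ℝ) ^ 2 := fun ω p => by
    have h1 := cut_le_mul_card (hf (cl p) (cl p)) (block e fun r => (ω r).1 p)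
      (block e fun r => (ω r).1 p)
    have h2 := abs_rectSum_le (hf (cl p) (cl p)) (block e fun r => (ω r).1 p)
      (block e fun r => (ω r).1 p)
    rw [card_block he] at h1 h2
    simp only [hJ]
    linarith
  let k : κ → ℝ := fun y => #(univ.filter fun a => cl a = y)
  let s : ι → κ → ℝ := fun p y => #(univ.filter fun a => cl a = y ∧ a ≠ p)
  have hks : ∀ p y, s p y ≤ k y := fun p y => by
    exact Nat.cast_le.2 (card_le_card (monotone_filter_right _ fun a _ ha => ha.1))
  have hoff : ∀ p q, q ≠ p → 𝔼 ω, J ω p q ≤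
      (c (cl p) (cl q) / k (cl p) + (k (cl q) - s p (cl q)) * (t : ℝ) ^ 2) / s p (cl q) +
        12 * T := fun p q hqp => by
    have h1 := expect_cut_block_le cl he (hf (cl p) (cl q)) hqp.symm
    have h2 := expect_abs_rectSum_block_le cl he (hf (cl p) (cl q)) hqp.symm
    simp only [hJ, hc]
    rw [expect_add_distrib, add_div, add_div, add_div]
    simp only [k, s]
    linarith
  -- The coefficient 3 is 2 from the trivial bound on the diagonal and 1 from the index missing in
  -- the class of `p`.
  have hrow : ∀ p, ∑ q, 𝔼 ω, J ω p q ≤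
      (∑ y ∈ Y, c (cl p) y) / k (cl p) + (3 * (t : ℝ) ^ 2 + Fintype.card ι * (12 * T)) := by
    intro p
    rw [← add_sum_erase _ _ (mem_univ p)]
    have h1 : 𝔼 ω, J ω p p ≤ 2 * (t : ℝ) ^ 2 := expect_le univ_nonempty fun ω _ => hdiag ω p
    have h2 := sum_le_sum fun q (hq : q ∈ univ.erase p) => hoff p q (ne_of_mem_erase hq)
    have h3 := sum_div_card_class_le cl hY p
      (c := fun y => c (cl p) y / k (cl p) + (k y - s p y) * (t : ℝ) ^ 2)
      (fun y _ => add_nonneg (div_nonneg (hc0 _ _) (Nat.cast_nonneg _))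
        (mul_nonneg (sub_nonneg.2 (hks p y)) (sq_nonneg _)))
    rw [sum_add_distrib, ← sum_mul, sum_card_class_sub cl hY p, ← sum_div] at h3
    rw [sum_add_distrib, sum_const, nsmul_eq_mul] at h2
    have h4 : (#(univ.erase p) : ℝ) * (12 * T) ≤ Fintype.card ι * (12 * T) := by
      have : #(univ.erase p) ≤ Fintype.card ι := card_le_univ _
      gcongr
    linarith
  have hmean : 𝔼 ω, ∑ p, ∑ q, J ω p q ≤ ∑ x ∈ Y, ∑ y ∈ Y, c x y +
      3 * Fintype.card ι * (t : ℝ) ^ 2 + 12 * (Fintype.card ι : ℝ) ^ 2 * T := by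
    rw [expect_sum_comm]
    simp only [expect_sum_comm]
    refine (sum_le_sum fun p _ => hrow p).trans ?_
    rw [sum_add_distrib, sum_const, card_univ, nsmul_eq_mul]
    have := sum_div_card_class_eq_le cl hY (c := fun x => ∑ y ∈ Y, c x y)
      (fun x _ => sum_nonneg fun y _ => hc0 x y)
    linarith
  obtain ⟨ω, -, hω⟩ := exists_le_of_expect_le univ_nonempty hmean
  refine ⟨fun p r => e ((ω r).1 p) r, ?_, hω⟩
  rintro ⟨p, r⟩ ⟨p', r'⟩ h
  have h := @he ((ω r).1 p, r) ((ω r').1 p', r') h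
  simp only [Prod.mk.injEq] at h
  obtain ⟨h1, rfl⟩ := h
  exact Prod.ext ((ω r).1.injective h1) rfl

end Rearrangement

/-! ### Equitable colourings extending the blocks. -/

section Balanced

/-- Any finite set can be distributed evenly. -/
lemma exists_balanced (α ι : Type) [Fintype α] [Fintype ι] [Nonempty ι] [DecidableEq ι] :
    ∃ (g : α → ι) (c : ℕ), ∀ p, #(univ.filter fun a => g a = p) = c ∨
      #(univ.filter fun a => g a = p) = c + 1 := by
  have hK : 0 < Fintype.card ι := Fintype.card_pos
  let ψ := Fintype.equivFin α
  let θ := Fintype.equivFin ι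
  refine ⟨fun a => θ.symm ⟨(ψ a : ℕ) % Fintype.card ι, Nat.mod_lt _ hK⟩,
    Fintype.card α / Fintype.card ι, fun p => ?_⟩
  have h : #(univ.filter fun a => θ.symm ⟨(ψ a : ℕ) % Fintype.card ι, Nat.mod_lt _ hK⟩ = p) =
      Nat.count (fun x => x ≡ θ p [MOD Fintype.card ι]) (Fintype.card α) := by
    rw [Nat.count_eq_card_filter_range]
    refine card_bij (fun a _ => (ψ a : ℕ)) (fun a ha => ?_)
      (fun a _ b _ hab => ψ.injective (Fin.ext hab)) fun j hj => ?_
    · simp only [mem_filter, mem_univ, true_and, mem_range, Equiv.symm_apply_eq] at ha ⊢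
      refine ⟨(ψ a).2, ?_⟩
      rw [Nat.ModEq, Nat.mod_eq_of_lt (θ p).2, ← ha]
    · simp only [mem_filter, mem_range] at hj
      refine ⟨ψ.symm ⟨j, hj.1⟩, ?_, by simp⟩
      simp only [mem_filter, mem_univ, true_and, Equiv.symm_apply_eq, Equiv.apply_symm_apply]
      ext
      have := hj.2
      rw [Nat.ModEq, Nat.mod_eq_of_lt (θ p).2] at this
      exact this
  rw [h, Nat.count_modEq_card _ hK]
  split_ifs <;> simp

variable {V ι : Type} [Fintype V] [DecidableEq V] [Fintype ι] [DecidableEq ι]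

/-- Disjoint blocks of equal size extend to an equitable colouring of all vertices. -/
lemma exists_balanced_extension [Nonempty ι] {t : ℕ} {e : ι → Fin t → V}
    (he : Function.Injective fun p : ι × Fin t => e p.1 p.2) :
    ∃ (χ : V → ι) (c : ℕ), (∀ p r, χ (e p r) = p) ∧
      ∀ p, #(univ.filter fun v => χ v = p) = c ∨ #(univ.filter fun v => χ v = p) = c + 1 := by
  classical
  obtain ⟨g, c, hg⟩ := exists_balanced {v // ∀ p r, e p r ≠ v} ι
  let χ : V → ι := fun v => if h : ∀ p r, e p r ≠ v then g ⟨v, h⟩ else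
    (not_forall.1 h).choose
  have hχ : ∀ p r, χ (e p r) = p := fun p r => by
    have h : ¬ ∀ p' r', e p' r' ≠ e p r := fun h => h p r rfl
    simp only [χ, dif_neg h]
    obtain ⟨r', hr'⟩ := not_forall.1 (not_forall.1 h).choose_spec
    exact congrArg Prod.fst (@he (_, r') (p, r) (not_not.1 hr'))
  -- A fibre is a block of size `t` together with `c` or `c + 1` of the remaining vertices.
  refine ⟨χ, t + c, hχ, fun p => ?_⟩
  have h : univ.filter (fun v => χ v = p) = univ.image (e p) ∪
      (univ.filter fun a => g a = p).map (Function.Embedding.subtype _) := by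
    ext v
    simp only [mem_filter, mem_univ, true_and, mem_union, mem_image, mem_map,
      Function.Embedding.coe_subtype, Subtype.exists, exists_and_right, exists_eq_right]
    by_cases hv : ∀ p r, e p r ≠ v
    · simp only [χ, dif_pos hv]
      constructor
      · exact fun h => Or.inr ⟨hv, h⟩
      · rintro (⟨r, hr⟩ | ⟨_, h⟩)
        · exact absurd hr (hv p r)
        · exact h
    · push Not at hv
      obtain ⟨p', r, rfl⟩ := hv
      rw [hχ]
      constructor
      · rintro rfl
        exact Or.inl ⟨r, rfl⟩
      · rintro (⟨r', hr'⟩ | ⟨h, -⟩)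
        · exact (congrArg Prod.fst (@he (p, r') (p', r) hr')).symm
        · exact absurd rfl (h p' r)
  have hd : Disjoint (univ.image (e p))
      ((univ.filter fun a => g a = p).map (Function.Embedding.subtype _)) := by
    rw [disjoint_left]
    intro v hv hv'
    obtain ⟨r, -, rfl⟩ := mem_image.1 hv
    obtain ⟨⟨w, hw⟩, -, h⟩ := mem_map.1 hv'
    exact hw p r h.symm
  have he' : Function.Injective (e p) := fun r r' h => congrArg Prod.snd (@he (p, r) (p, r') h)
  rw [h, card_union_of_disjoint hd, card_map, card_image_of_injective _ he', card_univ,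
    Fintype.card_fin]
  rcases hg p with h | h <;> omega

/-- The partition of the vertices into the classes of a surjective colouring. -/
def fiberPartition (χ : V → ι) (hχ : Function.Surjective χ) : Finpartition (univ : Finset V) :=
  Finpartition.ofExistsUnique (univ.image fun p => univ.filter fun v => χ v = p)
    (fun _ _ => subset_univ _)
    (fun v _ => ⟨univ.filter fun w => χ w = χ v, by simp, by
      rintro _ ⟨hs, hv⟩
      obtain ⟨p, -, rfl⟩ := mem_image.1 hs
      rw [(mem_filter.1 hv).2]⟩)
    (fun h => by
      obtain ⟨p, -, hp⟩ := mem_image.1 h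
      obtain ⟨v, rfl⟩ := hχ p
      exact notMem_empty v (hp ▸ mem_filter.2 ⟨mem_univ v, rfl⟩))

lemma fiberPartition_parts (χ : V → ι) (hχ : Function.Surjective χ) :
    (fiberPartition χ hχ).parts = univ.image fun p => univ.filter fun v => χ v = p := rfl

omit [DecidableEq V] [Fintype ι] in
lemma fiber_injective {χ : V → ι} (hχ : Function.Surjective χ) :
    Function.Injective fun p => (univ.filter fun v => χ v = p : Finset V) := fun p q h => by
  obtain ⟨v, rfl⟩ := hχ p
  have : v ∈ univ.filter fun w => χ w = q := by
    rw [← show _ = univ.filter fun w => χ w = q from h]; simp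
  exact (mem_filter.1 this).2

end Balanced

/-! ### From cut norms of the deviation to irregularity. -/

section Irregularity

variable {V : Type} (G : SimpleGraph V) [DecidableRel G.Adj]

/-- The deviation of the adjacency function of `G` from the density `c`. -/
def deviation (c : ℝ) (x y : V) : ℝ := (if G.Adj x y then 1 else 0) - c

lemma abs_deviation_le {c : ℝ} (h0 : 0 ≤ c) (h1 : c ≤ 1) (x y : V) : |deviation G c x y| ≤ 1 := by
  rw [deviation, abs_le]
  split_ifs <;> constructor <;> linarith

lemma rectSum_deviation (c : ℝ) (U W : Finset V) :
    rectSum (deviation G c) U W = #(G.interedges U W) - #U * #W * c := by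
  have h : (#(G.interedges U W) : ℝ) = ∑ x ∈ U, ∑ y ∈ W, if G.Adj x y then 1 else 0 := by
    rw [← sum_product', SimpleGraph.interedges, Rel.interedges, card_filter]
    push_cast
    rfl
  simp only [rectSum, deviation, sum_sub_distrib, sum_const, nsmul_eq_mul, h]
  ring

lemma edgeDensity_nonneg_real (X Y : Finset V) : (0 : ℝ) ≤ G.edgeDensity X Y := by
  exact_mod_cast G.edgeDensity_nonneg X Y

lemma edgeDensity_le_one_real (X Y : Finset V) : (G.edgeDensity X Y : ℝ) ≤ 1 := by
  exact_mod_cast G.edgeDensity_le_one X Y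

lemma card_mul_edgeDensity (X Y : Finset V) :
    (#X : ℝ) * #Y * G.edgeDensity X Y = #(G.interedges X Y) := by
  rw [SimpleGraph.edgeDensity_def]
  push_cast
  rcases eq_or_ne ((#X : ℝ) * #Y) 0 with h | h
  · have h1 := Rel.card_interedges_le_mul G.Adj X Y
    have h2 : #X * #Y = 0 := by exact_mod_cast h
    rw [h2, Nat.le_zero] at h1
    rw [h, zero_mul, SimpleGraph.interedges, h1, Nat.cast_zero]
  · exact mul_div_cancel₀ _ h

lemma pairIrreg_eq_cut (X Y : Finset V) :
    pairIrreg G X Y = cut (deviation G (G.edgeDensity X Y)) X Y := by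
  simp only [pairIrreg, cut, rectSum_deviation]

lemma rectSum_deviation_edgeDensity (X Y : Finset V) :
    rectSum (deviation G (G.edgeDensity X Y)) X Y = 0 := by
  rw [rectSum_deviation, card_mul_edgeDensity, sub_self]

/-- The irregularity may be measured against any reference density, at the cost of the total
deviation. -/
lemma pairIrreg_le_cut_add (c : ℝ) (X Y : Finset V) :
    pairIrreg G X Y ≤ cut (deviation G c) X Y + |rectSum (deviation G c) X Y| := by
  rw [pairIrreg_eq_cut]
  refine cut_le fun U hU W hW => ?_
  have h1 : rectSum (deviation G (G.edgeDensity X Y)) U W =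
      rectSum (deviation G c) U W - #U * #W * (G.edgeDensity X Y - c) := by
    rw [rectSum_deviation, rectSum_deviation]; ring
  have h2 : rectSum (deviation G c) X Y = #X * #Y * (G.edgeDensity X Y - c) := by
    rw [rectSum_deviation, ← card_mul_edgeDensity]; ring
  have h3 : |(#U * #W * (G.edgeDensity X Y - c) : ℝ)| ≤ |rectSum (deviation G c) X Y| := by
    rw [h2, abs_mul, abs_mul _ ((G.edgeDensity X Y : ℝ) - c), abs_of_nonneg (by positivity),
      abs_of_nonneg (a := (#X : ℝ) * #Y) (by positivity)]
    have := card_le_card hU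
    have := card_le_card hW
    gcongr
  rw [h1]
  exact (abs_sub _ _).trans (add_le_add (abs_rectSum_le_cut _ hU hW) h3)

lemma pairIrreg_le_mul_card (X Y : Finset V) : pairIrreg G X Y ≤ #X * #Y := by
  rw [pairIrreg_eq_cut]
  exact cut_le_mul_card (abs_deviation_le G (edgeDensity_nonneg_real G X Y)
    (edgeDensity_le_one_real G X Y)) X Y

lemma pairIrreg_nonneg (X Y : Finset V) : 0 ≤ pairIrreg G X Y := by
  rw [pairIrreg_eq_cut]
  exact cut_nonneg _ _ _

lemma pairIrreg_singleton (x y : V) : pairIrreg G {x} {y} = 0 := by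
  refine le_antisymm ?_ (pairIrreg_nonneg G _ _)
  rw [pairIrreg_eq_cut]
  refine cut_le fun U hU W hW => ?_
  rcases subset_singleton_iff.1 hU with rfl | rfl
  · simp [rectSum]
  rcases subset_singleton_iff.1 hW with rfl | rfl
  · simp [rectSum]
  rw [rectSum_deviation_edgeDensity, abs_zero]

variable [Fintype V] [DecidableEq V]

lemma irreg_bot : irreg G (⊥ : Finpartition (univ : Finset V)) = 0 := by
  simp [irreg, Finpartition.parts_bot, pairIrreg_singleton]

/-- Cutting the parts into blocks of size `t` at random and distributing the left-over vertices. -/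
lemma exists_equipartition_of_block_size (P : Finpartition (univ : Finset V)) {t : ℕ} (ht : 0 < t)
    (hP : #P.parts * t < Fintype.card V) :
    ∃ (K : ℕ) (Q : Finpartition (univ : Finset V)), K * t ≤ Fintype.card V ∧
      Fintype.card V ≤ K * t + #P.parts * t ∧ Q.IsEquipartition ∧ #Q.parts ≤ K ∧
      irreg G Q ≤ irreg G P + 12 * (K : ℝ) ^ 2 * (t * √t) + 3 * K * (t : ℝ) ^ 2 +
        3 * ((Fintype.card V : ℝ) ^ 2 - (K * t) ^ 2) := by
  let ι := Σ X : P.parts, Fin (#X.1 / t)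
  let cl : ι → Finset V := fun p => p.1.1
  have hcl : ∀ p, cl p ∈ P.parts := fun p => p.1.2
  have hemb : ∀ X : P.parts, Nonempty (Fin (#X.1 / t) × Fin t ↪ X.1) := fun X =>
    Function.Embedding.nonempty_of_card_le (by simpa using Nat.div_mul_le_self _ _)
  let emb := fun X => (hemb X).some
  let e : ι → Fin t → V := fun p r => (emb p.1 (p.2, r)).1
  have hecl : ∀ p r, e p r ∈ cl p := fun p r => (emb p.1 (p.2, r)).2
  have he : Function.Injective fun p : ι × Fin t => e p.1 p.2 := by
    rintro ⟨⟨X, i⟩, r⟩ ⟨⟨X', i'⟩, r'⟩ h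
    have hX : X = X' := Subtype.ext (P.disjoint.elim_finset X.2 X'.2 _ (hecl ⟨X, i⟩ r)
      ((show e ⟨X, i⟩ r = e ⟨X', i'⟩ r' from h) ▸ hecl ⟨X', i'⟩ r'))
    subst hX
    have h := (emb X).injective (Subtype.ext h : emb X (i, r) = emb X (i', r'))
    simp only [Prod.mk.injEq] at h
    rw [h.1, h.2]
  set K := Fintype.card ι with hK
  set n := Fintype.card V with hn
  have hKt : K * t ≤ n := by
    have := Fintype.card_le_of_injective _ he
    rwa [Fintype.card_prod, Fintype.card_fin] at this
  have hnK : n ≤ K * t + #P.parts * t := by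
    have h1 : K = ∑ X ∈ P.parts, #X / t := by
      rw [hK, Fintype.card_sigma]
      simp only [Fintype.card_fin]
      exact sum_coe_sort P.parts fun X => #X / t
    rw [h1, hn, ← card_univ, ← P.sum_card_parts, sum_mul, card_eq_sum_ones, sum_mul,
      ← sum_add_distrib]
    refine sum_le_sum fun X _ => ?_
    have := Nat.div_add_mod (#X) t
    have := Nat.mod_lt (#X) ht
    rw [mul_comm, one_mul]
    omega
  have hKpos : 0 < K := by
    rcases Nat.eq_zero_or_pos K with h | h
    · rw [h] at hnK; omega
    · exact h
  have : Nonempty ι := Fintype.card_pos_iff.1 hKpos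
  -- Pairs of blocks are measured against the density of the original pair of parts, which does not
  -- depend on the random choice.
  let f : Finset V → Finset V → V → V → ℝ := fun X Y => deviation G (G.edgeDensity X Y)
  have hf : ∀ X Y u v, |f X Y u v| ≤ 1 := fun X Y =>
    abs_deviation_le G (edgeDensity_nonneg_real G X Y) (edgeDensity_le_one_real G X Y)
  obtain ⟨e', he', hsum⟩ := exists_rearrangement cl hcl he hf
  obtain ⟨χ, c, hχ, hbal⟩ := exists_balanced_extension he'
  have hsurj : Function.Surjective χ := fun p => ⟨e' p ⟨0, ht⟩, hχ _ _⟩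
  have hcardB : ∀ p, #(univ.image (e' p)) = t := fun p => by
    rw [card_image_of_injective _ fun r r' h => congrArg Prod.snd (@he' (p, r) (p, r') h),
      card_univ, Fintype.card_fin]
  have hsub : ∀ p, univ.image (e' p) ⊆ univ.filter fun v => χ v = p := fun p v hv => by
    obtain ⟨r, -, rfl⟩ := mem_image.1 hv
    exact mem_filter.2 ⟨mem_univ _, hχ p r⟩
  have hcore : ∀ X, core cl e X ⊆ X := fun X v hv => by
    obtain ⟨⟨p, r⟩, hp, rfl⟩ := mem_image.1 hv
    rw [mem_product, mem_filter] at hp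
    exact hp.1.2 ▸ hecl p r
  refine ⟨K, fiberPartition χ hsurj, hKt, hnK, ?_, ?_, ?_⟩
  · refine Set.equitableOn_iff_exists_eq_eq_add_one.2 ⟨c, fun X hX => ?_⟩
    obtain ⟨p, -, rfl⟩ := mem_image.1 (mem_coe.1 hX)
    exact hbal p
  · rw [fiberPartition_parts]
    exact card_image_le.trans_eq card_univ
  have h1 : irreg G (fiberPartition χ hsurj) =
      ∑ p, ∑ q, pairIrreg G (univ.filter fun v => χ v = p) (univ.filter fun v => χ v = q) := by
    simp only [irreg, fiberPartition_parts,
      sum_image fun _ _ _ _ h => fiber_injective hsurj h]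
  have hfib : ∑ p, (#(univ.filter fun v => χ v = p) : ℝ) = n := by
    rw [hn, ← card_univ, card_eq_sum_card_fiberwise fun v _ => mem_univ (χ v)]
    push_cast
    rfl
  -- Pairs involving left-over vertices are charged twice, once for the cut norm and once for the
  -- total weight; `h4` charges them a third time.
  have h2 : ∀ p q, pairIrreg G (univ.filter fun v => χ v = p) (univ.filter fun v => χ v = q) ≤
      (cut (f (cl p) (cl q)) (univ.image (e' p)) (univ.image (e' q)) +
        |rectSum (f (cl p) (cl q)) (univ.image (e' p)) (univ.image (e' q))|) +
      2 * ((#(univ.filter fun v => χ v = p) : ℝ) * #(univ.filter fun v => χ v = q) - t * t) := by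
    intro p q
    have a1 := pairIrreg_le_cut_add G (G.edgeDensity (cl p) (cl q))
      (univ.filter fun v => χ v = p) (univ.filter fun v => χ v = q)
    have a2 := cut_le_cut_add (hf (cl p) (cl q)) (hsub p) (hsub q)
    have a3 := abs_rectSum_sub_le (hf (cl p) (cl q)) (hsub p) (hsub q)
    have a4 := abs_sub_abs_le_abs_sub
      (rectSum (f (cl p) (cl q)) (univ.filter fun v => χ v = p) (univ.filter fun v => χ v = q))
      (rectSum (f (cl p) (cl q)) (univ.image (e' p)) (univ.image (e' q)))
    rw [hcardB, hcardB] at a2 a3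
    simp only [f] at a2 a3 a4 ⊢
    linarith
  have h3 : ∑ p : ι, ∑ q : ι, 2 * ((#(univ.filter fun v => χ v = p) : ℝ) *
      #(univ.filter fun v => χ v = q) - t * t) = 2 * ((n : ℝ) ^ 2 - (K * t) ^ 2) := by
    simp only [← mul_sum, sum_sub_distrib, sum_const, card_univ, nsmul_eq_mul, hfib, ← sum_mul]
    rw [← hK]
    ring
  -- The deviation has total weight zero on `X × Y`, so on the cores its weight is at most the
  -- number of pairs removed. Hence `irreg G P` enters with coefficient 1.
  have h4 : ∀ X Y, cut (f X Y) (core cl e X) (core cl e Y) +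
      |rectSum (f X Y) (core cl e X) (core cl e Y)| ≤
      pairIrreg G X Y + ((#X : ℝ) * #Y - #(core cl e X) * #(core cl e Y)) := by
    intro X Y
    have a1 := cut_mono (f X Y) (hcore X) (hcore Y)
    have a2 := abs_rectSum_sub_le (hf X Y) (hcore X) (hcore Y)
    rw [rectSum_deviation_edgeDensity, zero_sub, abs_neg] at a2
    rw [pairIrreg_eq_cut]
    exact add_le_add a1 a2
  have hcoresum : ∑ X ∈ P.parts, (#(core cl e X) : ℝ) = K * t := by
    simp only [card_core cl he]
    rw [hK, ← card_univ, card_eq_sum_card_fiberwise fun p _ => hcl p]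
    push_cast
    rw [sum_mul]
  have hpartsum : ∑ X ∈ P.parts, (#X : ℝ) = n := by
    rw [hn, ← card_univ, ← P.sum_card_parts]
    push_cast
    rfl
  have h5 : ∑ X ∈ P.parts, ∑ Y ∈ P.parts, (cut (f X Y) (core cl e X) (core cl e Y) +
      |rectSum (f X Y) (core cl e X) (core cl e Y)|) ≤
      irreg G P + ((n : ℝ) ^ 2 - (K * t) ^ 2) := by
    refine (sum_le_sum fun X _ => sum_le_sum fun Y _ => h4 X Y).trans_eq ?_
    simp only [sum_add_distrib, sum_sub_distrib, ← mul_sum, ← sum_mul, hcoresum, hpartsum, irreg]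
    ring
  have h6 := sum_le_sum fun p (_ : p ∈ (univ : Finset ι)) =>
    sum_le_sum fun q (_ : q ∈ (univ : Finset ι)) => h2 p q
  rw [← h1] at h6
  simp only [sum_add_distrib] at h6 hsum h5
  rw [h3] at h6
  linarith

end Irregularity

/-! ### Existence of M(ε) from Szemerédi's regularity lemma. -/

section Existence

variable {V : Type} (G : SimpleGraph V) [DecidableRel G.Adj]

/-- Uniformity handles large `U` and `W`; if one of them is small, the trivial bound `#U * #W`
suffices. -/
lemma pairIrreg_le_of_isUniform {η : ℝ} {X Y : Finset V} (h : G.IsUniform η X Y) :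
    pairIrreg G X Y ≤ η * (#X * #Y) := by
  have hη : 0 < η := h.pos
  rw [pairIrreg_eq_cut]
  refine cut_le fun U hU W hW => ?_
  have hUX : (#U : ℝ) ≤ #X := by exact_mod_cast card_le_card hU
  have hWY : (#W : ℝ) ≤ #Y := by exact_mod_cast card_le_card hW
  have htriv := abs_rectSum_le (abs_deviation_le G (edgeDensity_nonneg_real G X Y)
    (edgeDensity_le_one_real G X Y)) U W
  by_cases h1 : (#X : ℝ) * η ≤ #U
  · by_cases h2 : (#Y : ℝ) * η ≤ #W
    · have h3 : rectSum (deviation G (G.edgeDensity X Y)) U W =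
          #U * #W * (G.edgeDensity U W - G.edgeDensity X Y) := by
        rw [rectSum_deviation, ← card_mul_edgeDensity]; ring
      rw [h3, abs_mul, abs_of_nonneg (by positivity), mul_comm]
      have := (h hU hW h1 h2).le
      gcongr
    · calc _ ≤ _ := htriv
        _ ≤ (#X : ℝ) * (#Y * η) := by gcongr; exact (not_le.1 h2).le
        _ = _ := by ring
  · calc _ ≤ _ := htriv
      _ ≤ (#X * η : ℝ) * #Y := by gcongr; exact (not_le.1 h1).le
      _ = _ := by ring

variable [Fintype V] [DecidableEq V]

/-- Uniform pairs contribute η n² and non-uniform ones 4 η n². `P.IsUniform` ignores pairs `X = Y`,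
so these are bounded trivially through the part size `s`. -/
lemma irreg_le_of_isUniform {η : ℝ} (hη : 0 < η) {P : Finpartition (univ : Finset V)}
    (hV : 0 < Fintype.card V) (hP : P.IsEquipartition) (hG : P.IsUniform G η) {s : ℝ}
    (hs : ∀ X ∈ P.parts, (#X : ℝ) ≤ s) :
    irreg G P ≤ 5 * η * (Fintype.card V : ℝ) ^ 2 + s * Fintype.card V := by
  have hsum : ∑ X ∈ P.parts, (#X : ℝ) = Fintype.card V := by
    rw [← card_univ, ← P.sum_card_parts]
    push_cast
    rfl
  have hpair : ∀ X ∈ P.parts, ∀ Y ∈ P.parts, pairIrreg G X Y ≤ η * (#X * #Y) +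
      ((if X = Y then (#X : ℝ) * #Y else 0) +
        if (X, Y) ∈ P.nonUniforms G η then (#X : ℝ) * #Y else 0) := by
    intro X hX Y hY
    have h0 : (0 : ℝ) ≤ η * (#X * #Y) := by positivity
    have h1 := pairIrreg_le_mul_card G X Y
    by_cases hXY : X = Y
    · rw [if_pos hXY]
      split_ifs <;> nlinarith
    · rw [if_neg hXY]
      by_cases hu : G.IsUniform η X Y
      · have := pairIrreg_le_of_isUniform G hu
        split_ifs <;> nlinarith
      · rw [if_pos (by simp [hX, hY, hXY, hu])]
        linarith
  have hnon : ∑ X ∈ P.parts, ∑ Y ∈ P.parts,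
      (if (X, Y) ∈ P.nonUniforms G η then (#X : ℝ) * #Y else 0) ≤
      4 * η * (Fintype.card V : ℝ) ^ 2 := by
    rw [← sum_product', ← sum_filter]
    have hfil : (P.parts ×ˢ P.parts).filter (fun p => (p.1, p.2) ∈ P.nonUniforms G η) =
        P.nonUniforms G η := by
      ext ⟨X, Y⟩
      simp only [mem_filter, mem_product, Finpartition.mk_mem_nonUniforms]
      tauto
    rw [hfil]
    have h1 := (hP.sum_nonUniforms_lt' (G := G) (card_pos.1 (by rwa [card_univ])) hη hG).le
    have h2 : (#P.parts : ℝ) ≤ #(univ : Finset V) := by exact_mod_cast P.card_parts_le_card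
    rw [card_univ] at h1 h2
    refine h1.trans ?_
    calc η * ((Fintype.card V : ℝ) + #P.parts) ^ 2
        ≤ η * ((Fintype.card V : ℝ) + Fintype.card V) ^ 2 := by gcongr
      _ = _ := by ring
  have hdiag : ∑ X ∈ P.parts, ∑ Y ∈ P.parts, (if X = Y then (#X : ℝ) * #Y else 0) ≤
      s * Fintype.card V := by
    rw [← hsum, mul_sum]
    refine sum_le_sum fun X hX => ?_
    rw [sum_ite_eq, if_pos hX]
    exact mul_le_mul_of_nonneg_right (hs X hX) (Nat.cast_nonneg _)
  calc irreg G P ≤ _ := sum_le_sum fun X hX => sum_le_sum fun Y hY => hpair X hX Y hY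
    _ ≤ _ := by
      simp only [sum_add_distrib, ← mul_sum, ← sum_mul, hsum] at hnon hdiag ⊢
      nlinarith

end Existence

/-- Without this, `M ε` could be the default value 0 of `sInf ∅`. At least 16/ε parts make each part
of size at most ε n / 8, and 5/16 + 1/8 < 1; graphs with fewer than `l` vertices are split into
singletons. -/
lemma sufficientParts_nonempty {ε : ℝ} (hε : 0 < ε) : (sufficientParts ε).Nonempty := by
  set l := ⌈16 / ε⌉₊ with hl
  have hlε : 16 / ε ≤ l := Nat.le_ceil _
  have hlpos : (0 : ℝ) < l := (by positivity : 0 < 16 / ε).trans_le hlε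
  refine ⟨max l (SzemerediRegularity.bound (ε / 16) l), fun V _ _ G _ => ?_⟩
  by_cases hV : l ≤ Fintype.card V
  · obtain ⟨P, hP, hPl, hPb, hPu⟩ := szemeredi_regularity G (by positivity : 0 < ε / 16) hV
    refine ⟨P, hPb.trans (le_max_right _ _), ?_⟩
    have hn : (l : ℝ) ≤ Fintype.card V := by exact_mod_cast hV
    have h16 : 16 ≤ ε * l := by rwa [div_le_iff₀' hε] at hlε
    have hs : ∀ X ∈ P.parts, (#X : ℝ) ≤ ε / 8 * Fintype.card V := fun X hX => by
      have h1 : (#X : ℝ) ≤ (Fintype.card V / #P.parts : ℕ) + 1 := by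
        have := hP.card_part_le_average_add_one hX
        rw [card_univ] at this
        exact_mod_cast this
      have h2 : ((Fintype.card V / #P.parts : ℕ) : ℝ) ≤ Fintype.card V / l := by
        refine Nat.cast_div_le.trans ?_
        have : (l : ℝ) ≤ #P.parts := by exact_mod_cast hPl
        gcongr
      have h3 : (Fintype.card V : ℝ) / l ≤ ε / 16 * Fintype.card V := by
        rw [div_le_iff₀ hlpos]
        nlinarith
      nlinarith
    have := irreg_le_of_isUniform G (by positivity) (by exact_mod_cast hlpos.trans_le hn) hP hPu hs
    nlinarith [sq_nonneg (Fintype.card V : ℝ)]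
  · refine ⟨⊥, ?_, ?_⟩
    · rw [Finpartition.card_bot, card_univ]
      exact (not_le.1 hV).le.trans (le_max_left _ _)
    · rw [irreg_bot]
      positivity

/-! ### Choice of the block size and of the exponent. -/

lemma pos_of_mem_sufficientParts {ε : ℝ} {m : ℕ} (hm : m ∈ sufficientParts ε) : 0 < m := by
  obtain ⟨P, hP, -⟩ := hm Unit ⊥
  exact (card_pos.2 (P.parts_nonempty (univ_nonempty.ne_empty))).trans_le hP

/-- A graph with many vertices has an equitable partition with few parts and nearly optimal
irregularity. -/
lemma exists_equipartition_of_large {V : Type} [Fintype V] [DecidableEq V] (G : SimpleGraph V)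
    [DecidableRel G.Adj] {ε α : ℝ} (hα : 0 < α) (hα2 : α < 1 / 2) {m : ℕ} (hm : 0 < m)
    (P : Finpartition (univ : Finset V)) (hPm : #P.parts ≤ m)
    (hP : irreg G P ≤ ε * (Fintype.card V : ℝ) ^ 2)
    (hn : 2 ^ 14 * m ≤ α ^ 3 * Fintype.card V) :
    ∃ Q : Finpartition (univ : Finset V), Q.IsEquipartition ∧ (#Q.parts : ℝ) * α ≤ 36 * m ∧
      irreg G Q ≤ (ε + α) * (Fintype.card V : ℝ) ^ 2 := by
  set n := Fintype.card V
  have hm1 : (1 : ℝ) ≤ m := by exact_mod_cast hm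
  have hm0 : (0 : ℝ) < m := by linarith
  -- The left-over and diagonal errors `e3` and `e2` are 6 m t n and 3 m t n; the factor 18 makes
  -- their sum at most α n² / 2.
  set τ : ℝ := α * n / (18 * m) with hτ
  have hτm : τ * (18 * m) = α * n := by rw [hτ]; field_simp
  have hα3 : α ^ 3 * n = α ^ 2 * (α * n) := by ring
  have hτα : 2 ^ 14 ≤ α ^ 2 * τ * 18 := by
    rw [hα3, ← hτm] at hn
    have : (2 ^ 14 : ℝ) * m ≤ (α ^ 2 * τ * 18) * m := by linarith
    exact le_of_mul_le_mul_right this hm0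
  have hα4 : α ^ 2 ≤ 1 / 4 := by nlinarith
  have hτ0 : 0 ≤ τ := by positivity
  -- Rounding `τ` down loses less than 1, leaving 576 = 24²; then 24 ≤ α √t, which bounds the
  -- sampling error `e1` by α n² / 2.
  have hτ577 : 577 ≤ α ^ 2 * τ := by linarith
  have hτ1 : 2 ≤ τ := by nlinarith
  set t := ⌊τ⌋₊ with ht
  have htle : (t : ℝ) ≤ τ := Nat.floor_le hτ0
  have htge : τ < t + 1 := Nat.lt_floor_add_one τ
  have ht1 : (1 : ℝ) ≤ t := by
    have : 1 ≤ t := Nat.le_floor (by push_cast; linarith)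
    exact_mod_cast this
  have ht576 : 576 ≤ α ^ 2 * t := by nlinarith
  have hn0 : (0 : ℝ) < n := by
    by_contra h
    have : (n : ℝ) = 0 := le_antisymm (not_lt.1 h) (Nat.cast_nonneg n)
    rw [this, mul_zero] at hn
    linarith
  have hmt : 18 * (m * t : ℝ) ≤ α * n := by
    rw [← hτm]
    nlinarith
  have hPt : (#P.parts * t : ℝ) ≤ m * t := by
    have : (#P.parts : ℝ) ≤ m := by exact_mod_cast hPm
    gcongr
  have hlt : #P.parts * t < n := by
    have : (#P.parts * t : ℝ) < n := by nlinarith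
    exact_mod_cast this
  obtain ⟨K, Q, hKn, hnK, hQ, hQK, hirr⟩ :=
    exists_equipartition_of_block_size G P (by exact_mod_cast ht1) hlt
  have hKn' : (K * t : ℝ) ≤ n := by exact_mod_cast hKn
  have hnK' : (n : ℝ) ≤ K * t + #P.parts * t := by exact_mod_cast hnK
  have hK0 : (0 : ℝ) ≤ K := Nat.cast_nonneg K
  refine ⟨Q, hQ, ?_, ?_⟩
  · have h1 : (#Q.parts : ℝ) ≤ K := by exact_mod_cast hQK
    have h2 : α * n ≤ t * (36 * m) := by
      rw [← hτm]
      nlinarith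
    have h3 : (K * α) * t ≤ (36 * m) * t := by nlinarith
    exact (mul_le_mul_of_nonneg_right h1 hα.le).trans
      (le_of_mul_le_mul_right h3 (by linarith))
  · have hsq : 24 ≤ α * √t := by
      refine abs_le_of_sq_le_sq (a := 24) ?_ (by positivity) |> fun h => (abs_le.1 h).2
      rw [mul_pow, Real.sq_sqrt (Nat.cast_nonneg t)]
      linarith
    have hs0 : 0 ≤ √(t : ℝ) := Real.sqrt_nonneg _
    have hss : √(t : ℝ) * √t = t := Real.mul_self_sqrt (Nat.cast_nonneg t)
    have e1 : 12 * (K : ℝ) ^ 2 * (t * √t) ≤ α / 2 * n ^ 2 := by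
      have h1 : (K * t : ℝ) ^ 2 ≤ n ^ 2 := by gcongr
      calc 12 * (K : ℝ) ^ 2 * (t * √t) = 24 * ((K : ℝ) ^ 2 * (t * √t) / 2) := by ring
        _ ≤ (α * √t) * ((K : ℝ) ^ 2 * (t * √t) / 2) := by gcongr
        _ = α / 2 * (K ^ 2 * t * (√t * √t)) := by ring
        _ = α / 2 * (K * t) ^ 2 := by rw [hss]; ring
        _ ≤ _ := by gcongr
    have e2 : 3 * (K : ℝ) * (t : ℝ) ^ 2 ≤ 3 * (m * t) * n := by
      calc 3 * (K : ℝ) * (t : ℝ) ^ 2 = 3 * (1 * t) * (K * t) := by ring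
        _ ≤ _ := by gcongr
    have e3 : 3 * ((n : ℝ) ^ 2 - (K * t) ^ 2) ≤ 6 * (m * t) * n := by
      have h1 : (n : ℝ) - K * t ≤ m * t := by linarith
      have h2 : (n : ℝ) + K * t ≤ 2 * n := by linarith
      calc 3 * ((n : ℝ) ^ 2 - (K * t) ^ 2) = 3 * ((n - K * t) * (n + K * t)) := by ring
        _ ≤ 3 * ((m * t) * (2 * n)) := by gcongr
        _ = _ := by ring
    have e4 : 18 * (m * t : ℝ) * n ≤ α * n * n := by gcongr
    nlinarith

/-- The exponent 17 = 14 + 3 comes from small graphs, where n < 2^14 α⁻³ m and 2^14 ≤ α⁻¹⁴ because α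
< 1/2. The bound 36 m / α for large graphs is weaker than needed by far. -/
lemma mem_sufficientEquitableParts {ε α : ℝ} (hε : 0 < ε) (hα : 0 < α) (hα2 : α < 1 / 2) {m : ℕ}
    (hm : m ∈ sufficientParts ε) : ⌊α ^ (-17 : ℝ) * m⌋₊ ∈ sufficientEquitableParts (ε + α) := by
  intro V _ _ G _
  have hm0 := pos_of_mem_sufficientParts hm
  have hpow : α ^ (-17 : ℝ) * α ^ 17 = 1 := by
    rw [← Real.rpow_natCast, ← Real.rpow_add hα]
    norm_num
  have hp0 : 0 < α ^ (-17 : ℝ) := Real.rpow_pos_of_pos hα _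
  have hhalf : ∀ k : ℕ, α ^ k ≤ (1 / 2) ^ k := fun k => pow_le_pow_left₀ hα.le hα2.le k
  by_cases hn : (2 ^ 14 * m : ℝ) ≤ α ^ 3 * Fintype.card V
  · obtain ⟨P, hPm, hP⟩ := hm V G
    obtain ⟨Q, hQ, hQm, hirr⟩ := exists_equipartition_of_large G hα hα2 hm0 P hPm hP hn
    refine ⟨Q, hQ, Nat.le_floor ?_, hirr⟩
    have h1 : α ^ 17 * (#Q.parts : ℝ) ≤ (m : ℝ) := by
      calc α ^ 17 * (#Q.parts : ℝ) = α ^ 16 * (#Q.parts * α) := by ring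
        _ ≤ (1 / 2 : ℝ) ^ 16 * (36 * m) := by gcongr
        _ ≤ (m : ℝ) := by
          have : (0 : ℝ) ≤ m := Nat.cast_nonneg m
          linarith
    calc (#Q.parts : ℝ) = α ^ (-17 : ℝ) * (α ^ 17 * #Q.parts) := by
          rw [← mul_assoc, hpow, one_mul]
      _ ≤ _ := by gcongr
  · refine ⟨⊥, Finpartition.bot_isEquipartition _, Nat.le_floor ?_, ?_⟩
    · rw [Finpartition.card_bot, card_univ]
      have h1 : α ^ 17 * (Fintype.card V : ℝ) ≤ (m : ℝ) := by
        calc α ^ 17 * (Fintype.card V : ℝ) = α ^ 14 * (α ^ 3 * Fintype.card V) := by ring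
          _ ≤ (1 / 2 : ℝ) ^ 14 * (2 ^ 14 * m) :=
            mul_le_mul (hhalf 14) (not_le.1 hn).le (by positivity) (by positivity)
          _ = (m : ℝ) := by ring
      calc (Fintype.card V : ℝ) = α ^ (-17 : ℝ) * (α ^ 17 * Fintype.card V) := by
            rw [← mul_assoc, hpow, one_mul]
        _ ≤ _ := by gcongr
    · rw [irreg_bot]
      positivity

end EquitableRegularity

end

theorem theorem2p2 :
    ∃ C : ℝ, 0 < C ∧ ∀ ε α : ℝ, 0 < ε → ε < 1 → 0 < α → α < 1 / 2 →
      IsLeast (EquitableRegularity.sufficientParts ε) (EquitableRegularity.M ε) ∧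
      IsLeast (EquitableRegularity.sufficientEquitableParts (ε + α))
        (EquitableRegularity.Meq (ε + α)) ∧
      (EquitableRegularity.Meq (ε + α) : ℝ) ≤ α ^ (-C) * (EquitableRegularity.M ε : ℝ) := by
  refine ⟨17, by norm_num, fun ε α hε _ hα hα2 => ?_⟩
  have hM := Nat.sInf_mem (EquitableRegularity.sufficientParts_nonempty hε)
  have hMeq := EquitableRegularity.mem_sufficientEquitableParts hε hα hα2 hM
  refine ⟨⟨hM, fun m hm => Nat.sInf_le hm⟩,
    ⟨Nat.sInf_mem ⟨_, hMeq⟩, fun m hm => Nat.sInf_le hm⟩, ?_⟩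
  exact (Nat.cast_le.2 (Nat.sInf_le hMeq)).trans
    (Nat.floor_le (mul_nonneg (Real.rpow_nonneg hα.le _) (Nat.cast_nonneg _)))
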